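/- **Setting.** Let $\mathcal R$ (reliable agents, $|\mathcal R|\ge 2$) and $\mathcal B$ (Byzantine agents) be finite sets, and let $\mathcal G$ be an undirected graph on $\mathcal R\cup\mathcal B$ whose restriction $\mathcal G_{\mathcal R}=(\mathcal R,\mathcal E_{\mathcal R})$ to $\mathcal R$ is connected; $\mathcal R_i,\mathcal B_i$ are the reliable and Byzantine neighbours of $i\in\mathcal R$. Agent $i\in\mathcal R$ holds $f_i=\frac1{q_i}\sum_{l=1}^{q_i}f_i^l$ on $\mathbb R^n$ ($n,q_i\ge1$), where $f_i$ is $\mu_i$-strongly convex ($\mu_i>0$) and $f_i^l$ is differentiable with $L_i^l$-Lipschitz gradient; $g:\mathbb R^n\to\mathbb R$ is convex. Let $\tilde x^*$ minimize $\sum_{i\in\mathcal R}(f_i+g)$, and put $\mu=\min_i\mu_i$, $L=\max_{i,l}L_i^l$, $\kappa_f=L/\mu$, $\gamma=\mu L/(\mu+L)$, $q_{\min}=\min_i q_i$, $q_{\max}=\max_i q_i$, $\kappa_q=q_{\max}/q_{\min}$. **Algorithms.** Fix $a\ge1$, $\|v\|_a=(\sum_e|v_e|^a)^{1/a}$, a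 penalty $\phi>0$, step sizes $\alpha_k>0$ and an arbitrary deterministic start $x_0=(x_{i,0})_{i\in\mathcal R}$. At iteration $k$ each $i\in\mathcal R$ receives $x_{j,k}$ from $j\in\mathcal R_i$ and an arbitrary vector $z_{ij,k}$ from $j\in\mathcal B_i$ (possibly depending on the whole past, but not on future random draws), and sets $$\bar x_{i,k}=x_{i,k}-\alpha_k r_{i,k}-\alpha_k\phi\Big(\sum_{j\in\mathcal R_i}\partial_{x_i}\|x_{i,k}-x_{j,k}\|_a+\sum_{j\in\mathcal B_i}\partial_{x_i}\|x_{i,k}-z_{ij,k}\|_a\Big),$$ $$x_{i,k+1}=\arg\min_{y}\Big\{g(y)+\tfrac1{2\alpha_k}\|y-\bar x_{i,k}\|_2^2\Big\},$$ where $\partial_{x_i}$ denotes any subgradient, those used by two adjacent reliable agents for their common edge being opposite to each other. With an index $s=s_{i,k}$ uniform on $\{1,\dots,q_i\}$ and independent of the past: * *Prox-DBRO-SAGA:* $r_{i,k}=\nabla f_i^{s}(x_{i,k})-\nabla f_i^{s}(u_{i,k}^{s})+\frac1{q_i}\sum_l\nabla f_i^l(u_{i,k}^l)$, with $u_{i,0}^l=x_{i,0}$,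 $u_{i,k+1}^{s}=x_{i,k}$ and $u_{i,k+1}^l=u_{i,k}^l$ for $l\ne s$. * *Prox-DBRO-LSVRG:* the same $r_{i,k}$ with every $u_{i,k}^l$ replaced by $w_{i,k}$, where $w_{i,0}=x_{i,0}$ and, independently of the past, $w_{i,k+1}=x_{i,k}$ with probability $p_i\in[1/q_{\max},1/q_{\min}]$ and $w_{i,k+1}=w_{i,k}$ otherwise. **Statement.** Suppose that for some $g'\in\partial g(\tilde x^*)$ $$\phi\ \ge\ \frac{|\mathcal R|^{3/2}\sqrt{|\mathcal E_{\mathcal R}|}\,\max_{i\in\mathcal R}\|\nabla f_i(\tilde x^*)+g'\|_\infty}{\lambda_{\min}(\Pi)},$$ where $\Pi$ is the oriented node-edge incidence matrix of $\mathcal G_{\mathcal R}$ and $\lambda_{\min}$ its smallest nonzero singular value, and that $|\mathcal B|=r_a|\mathcal R|$ with an arbitrary finite $r_a>0$. Write $\|x_k-1\otimes\tilde x^*\|_2^2=\sum_{i\in\mathcal R}\|x_{i,k}-\tilde x^*\|_2^2$. Then, for both algorithms, this quantity is integrable for every $k\ge0$, and the following hold. 1. (Linear rate.) If $\alpha_k\equiv\alpha$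 with $0<\alpha\le 1/\big(\kappa_q(32(1+\kappa_f)^2+q_{\min})\mu\big)$, then $0<1-\frac\gamma4\alpha<1$ and, for all $k\ge0$, $$\mathbb E\|x_k-1\otimes\tilde x^*\|_2^2\le\Big(1-\frac\gamma4\alpha\Big)^kU_0+4n\Big(4\alpha\,\frac{4+r_a^2}{\gamma}+\Big(\frac{r_a}{\gamma}\Big)^2\Big)\phi^2|\mathcal R|^3,$$ where $U_0=\|x_0-1\otimes\tilde x^*\|_2^2+\frac{q_{\min}\gamma\alpha}{q_{\max}L}t_0$ and $t_0=\sum_{i\in\mathcal R}\frac1{q_i}\sum_{l=1}^{q_i}\big(f_i^l(x_{i,0})-f_i^l(\tilde x^*)-\langle\nabla f_i^l(\tilde x^*),x_{i,0}-\tilde x^*\rangle\big)$. 2. (Sublinear rate.) If moreover, for some $\hat G>0$, every subgradient $v$ of $g$ at any point satisfies $\|v\|_2^2\le\hat G$, and $\alpha_k=\theta/(k+\xi)$ with $\theta>4/\gamma$ and $\xi=\kappa_q(64(1+\kappa_f)^2+q_{\min})\mu\theta$, then for all $k\ge0$ $$\mathbb E\|x_k-1\otimes\tilde x^*\|_2^2\le\frac{\Xi}{k+\xi}+4n\Big(\frac{r_a}{\gamma}\Big)^2\phi^2|\mathcal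 R|^3,$$ $$\Xi=\max\Big\{\frac{\theta^2\big(16|\mathcal R|\hat G+4n\phi^2|\mathcal R|^3(4+r_a^2)\big)}{\gamma\theta/4-1},\ \xi\,\|x_0-1\otimes\tilde x^*\|_2^2\Big\}.$$ Thus both algorithms converge, linearly or at rate $O(1/k)$, to an error ball of bounded radius around the optimal solution, with no upper bound on the proportion of Byzantine agents. -/

import Mathlib

open MeasureTheory ProbabilityTheory Filter

noncomputable section

/-- The `a`-norm `(∑ e, |v e| ^ a) ^ (1 / a)` of a vector of `ℝⁿ`, for real `a ≥ 1`. -/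
def aNorm {n : ℕ} (a : ℝ) (v : EuclideanSpace ℝ (Fin n)) : ℝ :=
  (∑ e, |v e| ^ a) ^ (1 / a)

/-- The max-norm of a vector of `ℝⁿ`. -/
def maxNorm {n : ℕ} (v : EuclideanSpace ℝ (Fin n)) : ℝ := ⨆ e, |v e|

/-- The subdifferential of `h : ℝⁿ → ℝ` at `x`. -/
def subdifferential {n : ℕ} (h : EuclideanSpace ℝ (Fin n) → ℝ) (x : EuclideanSpace ℝ (Fin n)) :
    Set (EuclideanSpace ℝ (Fin n)) :=
  {y | ∀ z, h x + inner ℝ y (z - x) ≤ h z}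

/-- `p` is the value at `x` of the proximal operator of `g` with parameter `α`. -/
def IsProx {n : ℕ} (α : ℝ) (g : EuclideanSpace ℝ (Fin n) → ℝ)
    (x p : EuclideanSpace ℝ (Fin n)) : Prop :=
  ∀ y, g p + 1 / (2 * α) * ‖p - x‖ ^ 2 ≤ g y + 1 / (2 * α) * ‖y - x‖ ^ 2

/-- The data of the composite finite-sum problem: agent `i` holds `q i ≥ 1` component functions
`f i l : ℝⁿ → ℝ`, and `g : ℝⁿ → ℝ` is shared by all reliable agents. -/
structure CompositeProblem (R : Type*) (n : ℕ) where
  q : R → ℕ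
  q_pos : ∀ i, 0 < q i
  f : (i : R) → Fin (q i) → EuclideanSpace ℝ (Fin n) → ℝ
  g : EuclideanSpace ℝ (Fin n) → ℝ

namespace CompositeProblem

variable {R : Type*} {n : ℕ} (pb : CompositeProblem R n)

/-- The local objective `f_i`, the average of the components of agent `i`. -/
def localObj (i : R) (y : EuclideanSpace ℝ (Fin n)) : ℝ := (∑ l, pb.f i l y) / (pb.q i : ℝ)

/-- `f_i` is `μ_i`-strongly convex, `f_i^l` is `L_i^l`-smooth, and `g` is convex. -/
structure ConvexSmooth (μi : R → ℝ) (Lil : (i : R) → Fin (pb.q i) → ℝ) : Prop where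
  mu_pos : ∀ i, 0 < μi i
  differentiable : ∀ i l, Differentiable ℝ (pb.f i l)
  strong : ∀ i y z, μi i * ‖y - z‖ ^ 2 ≤
    inner ℝ (gradient (pb.localObj i) y - gradient (pb.localObj i) z) (y - z)
  smooth : ∀ i l y z, ‖gradient (pb.f i l) y - gradient (pb.f i l) z‖ ≤ Lil i l * ‖y - z‖
  convex_g : ConvexOn ℝ Set.univ pb.g

/-- `xs` minimizes `∑ i, (f_i + g)` over `ℝⁿ`. -/
def IsOptimal [Fintype R] (xs : EuclideanSpace ℝ (Fin n)) : Prop :=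
  ∀ y, ∑ i, (pb.localObj i xs + pb.g xs) ≤ ∑ i, (pb.localObj i y + pb.g y)

/-- The smallest number of local samples. -/
def qmin : ℕ := ⨅ i, pb.q i

/-- The largest number of local samples. -/
def qmax : ℕ := ⨆ i, pb.q i

/-- The ratio `qmax / qmin`. -/
def kappaQ : ℝ := (pb.qmax : ℝ) / (pb.qmin : ℝ)

/-- The gradient-learning quantity
`∑ i, (1 / q_i) ∑ l, (f_i^l(u_i^l) - f_i^l(xs) - ⟨∇ f_i^l(xs), u_i^l - xs⟩)`. -/
def gradLearn [Fintype R] (xs : EuclideanSpace ℝ (Fin n))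
    (u : (i : R) → Fin (pb.q i) → EuclideanSpace ℝ (Fin n)) : ℝ :=
  ∑ i, (1 / (pb.q i : ℝ)) * ∑ l, (pb.f i l (u i l) - pb.f i l xs
    - inner ℝ (gradient (pb.f i l) xs) (u i l - xs))

/-- The SAGA table `u_{i,k}^l` along a path of iterates `x` and of drawn samples `s`. -/
def sagaTable (x : ℕ → R → EuclideanSpace ℝ (Fin n)) (s : ℕ → (i : R) → Fin (pb.q i)) :
    ℕ → (i : R) → Fin (pb.q i) → EuclideanSpace ℝ (Fin n)
  | 0 => fun i _ => x 0 i
  | k + 1 => fun i l => if l = s k i then x k i else sagaTable x s k i l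

/-- The SAGA estimator `r_{i,k}^u`. -/
def sagaEstimator (x : ℕ → R → EuclideanSpace ℝ (Fin n)) (s : ℕ → (i : R) → Fin (pb.q i))
    (k : ℕ) (i : R) : EuclideanSpace ℝ (Fin n) :=
  gradient (pb.f i (s k i)) (x k i)
    - gradient (pb.f i (s k i)) (pb.sagaTable x s k i (s k i))
    + (1 / (pb.q i : ℝ)) • ∑ l, gradient (pb.f i l) (pb.sagaTable x s k i l)

end CompositeProblem

/-- The LSVRG reference point `w_{i,k}` along a path of iterates `x` and of triggers `c`
(`c k i = true` means that agent `i` refreshes its reference point at iteration `k`). -/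
def lsvrgPoint {R : Type*} {n : ℕ} (x : ℕ → R → EuclideanSpace ℝ (Fin n)) (c : ℕ → R → Bool) :
    ℕ → R → EuclideanSpace ℝ (Fin n)
  | 0 => x 0
  | k + 1 => fun i => if c k i = true then x k i else lsvrgPoint x c k i

/-- The LSVRG estimator `r_{i,k}^w`. -/
def CompositeProblem.lsvrgEstimator {R : Type*} {n : ℕ} (pb : CompositeProblem R n)
    (x : ℕ → R → EuclideanSpace ℝ (Fin n)) (s : ℕ → (i : R) → Fin (pb.q i)) (c : ℕ → R → Bool)
    (k : ℕ) (i : R) : EuclideanSpace ℝ (Fin n) :=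
  gradient (pb.f i (s k i)) (x k i)
    - gradient (pb.f i (s k i)) (lsvrgPoint x c k i)
    + (1 / (pb.q i : ℝ)) • ∑ l, gradient (pb.f i l) (lsvrgPoint x c k i)

/-- The graph induced on the reliable agents. In `R ⊕ B` the left summand consists of the reliable
agents and the right one of the Byzantine agents. -/
def reliableGraph {R B : Type*} (Gr : SimpleGraph (R ⊕ B)) : SimpleGraph R := Gr.comap Sum.inl

open Classical in
/-- The node-edge incidence matrix of a graph, edges being oriented from the smaller endpoint
to the larger one. -/
def incidence {R : Type*} [LinearOrder R] (H : SimpleGraph R) : Matrix R H.edgeSet ℝ :=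
  fun i e => if i = (e : Sym2 R).inf then 1 else if i = (e : Sym2 R).sup then -1 else 0

open Classical in
/-- The minimum nonzero singular value of a real matrix. -/
def minSingularValue {m p : Type*} [Fintype m] [Fintype p] (A : Matrix m p ℝ) : ℝ :=
  sInf {σ : ℝ | 0 < σ ∧ ∃ j : ℕ, (Matrix.toEuclideanLin A).singularValues j = σ}

open Classical in
/-- The threshold
`|R| ^ (3/2) * √|E_R| * max_i ‖∇ f_i(xs) + g'‖_∞ / λ_min(Π)` on the penalty parameter. -/
def phiMin {R B : Type*} [Fintype R] [LinearOrder R] {n : ℕ} (pb : CompositeProblem R n)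
    (Gr : SimpleGraph (R ⊕ B)) (xs g' : EuclideanSpace ℝ (Fin n)) : ℝ :=
  (Fintype.card R : ℝ) ^ (3 / 2 : ℝ) * √((reliableGraph Gr).edgeSet.ncard : ℝ)
    * (⨆ i, maxNorm (gradient (pb.localObj i) xs + g'))
    / minSingularValue (incidence (reliableGraph Gr))

open Classical in
/-- One path of the Byzantine-resilient proximal scheme with step sizes `α`, penalty `φ`, norm
exponent `a` and gradient estimates `r`: `z k i b` is the arbitrary vector that the Byzantine agent
`b` sends to the reliable agent `i` at iteration `k`, `d i j` (resp. `e i b`) is the subgradient of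
`‖x_i - x_j‖_a` (resp. `‖x_i - z_{ib}‖_a`) with respect to `x_i` that agent `i` uses. Along an edge
between reliable agents the two subgradients are opposite to each other, so that stacked over the
agents they form a subgradient of the edge penalty `∑_{(i,j)} ‖x_i - x_j‖_a`. -/
def IsProxDBROPath {R B : Type*} [Fintype R] [Fintype B] {n : ℕ}
    (g : EuclideanSpace ℝ (Fin n) → ℝ) (Gr : SimpleGraph (R ⊕ B)) (a φ : ℝ) (α : ℕ → ℝ)
    (r : ℕ → R → EuclideanSpace ℝ (Fin n)) (z : ℕ → R → B → EuclideanSpace ℝ (Fin n))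
    (x : ℕ → R → EuclideanSpace ℝ (Fin n)) : Prop :=
  ∀ k, ∃ (d : R → R → EuclideanSpace ℝ (Fin n)) (e : R → B → EuclideanSpace ℝ (Fin n)),
    (∀ i j, (reliableGraph Gr).Adj i j →
      d i j ∈ subdifferential (fun y => aNorm a (y - x k j)) (x k i) ∧ d j i = - d i j) ∧
    (∀ i b, Gr.Adj (Sum.inl i) (Sum.inr b) →
      e i b ∈ subdifferential (fun y => aNorm a (y - z k i b)) (x k i)) ∧
    ∀ i, IsProx (α k) g
      (x k i - α k • r k i - (α k * φ) •
        ((∑ j with (reliableGraph Gr).Adj i j, d i j)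
          + ∑ b with Gr.Adj (Sum.inl i) (Sum.inr b), e i b))
      (x (k + 1) i)

/-- The draw `s k i` at iteration `k` is uniform on the samples of agent `i`, independent of the
history `ℱ k`, and known at time `k + 1`. -/
def UniformDraws {R Ω : Type*} {n : ℕ} (pb : CompositeProblem R n) {mΩ : MeasurableSpace Ω}
    (P : Measure Ω) (ℱ : Filtration ℕ mΩ) (s : ℕ → Ω → (i : R) → Fin (pb.q i)) : Prop :=
  ∀ k i, Measurable[ℱ (k + 1)] (fun ω => s k ω i) ∧
    Indep (MeasurableSpace.comap (fun ω => s k ω i) ⊤) (ℱ k) P ∧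
    ∀ l, P.real {ω | s k ω i = l} = 1 / (pb.q i : ℝ)

/-- The trigger `c k i` at iteration `k` equals `true` with probability `p i`, is independent of
the history `ℱ k`, and is known at time `k + 1`. -/
def BernoulliTriggers {R Ω : Type*} {mΩ : MeasurableSpace Ω}
    (P : Measure Ω) (ℱ : Filtration ℕ mΩ) (p : R → ℝ) (c : ℕ → Ω → R → Bool) : Prop :=
  ∀ k i, Measurable[ℱ (k + 1)] (fun ω => c k ω i) ∧
    Indep (MeasurableSpace.comap (fun ω => c k ω i) ⊤) (ℱ k) P ∧
    P.real {ω | c k ω i = true} = p i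

/-- `x` is a random sequence of iterates of Prox-DBRO-SAGA started at `x0`. The iterates are adapted
to the history, that is, the attack may use the whole past but not the future draws. -/
def IsProxDBROSaga {R B Ω : Type*} [Fintype R] [Fintype B] {n : ℕ} (pb : CompositeProblem R n)
    (Gr : SimpleGraph (R ⊕ B)) (a φ : ℝ) (α : ℕ → ℝ) (x0 : R → EuclideanSpace ℝ (Fin n))
    {mΩ : MeasurableSpace Ω} (P : Measure Ω) (ℱ : Filtration ℕ mΩ)
    (x : ℕ → Ω → R → EuclideanSpace ℝ (Fin n)) : Prop :=
  (∀ ω, x 0 ω = x0) ∧ (∀ k i, Measurable[ℱ k] (fun ω => x k ω i)) ∧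
  ∃ (s : ℕ → Ω → (i : R) → Fin (pb.q i)) (z : ℕ → Ω → R → B → EuclideanSpace ℝ (Fin n)),
    UniformDraws pb P ℱ s ∧
    ∀ ω, IsProxDBROPath pb.g Gr a φ α
      (pb.sagaEstimator (fun k => x k ω) (fun k => s k ω)) (fun k => z k ω) (fun k => x k ω)

/-- `x` is a random sequence of iterates of Prox-DBRO-LSVRG started at `x0`, with triggering
probabilities `p i` between `1 / qmax` and `1 / qmin`. -/
def IsProxDBROLsvrg {R B Ω : Type*} [Fintype R] [Fintype B] {n : ℕ} (pb : CompositeProblem R n)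
    (Gr : SimpleGraph (R ⊕ B)) (a φ : ℝ) (α : ℕ → ℝ) (x0 : R → EuclideanSpace ℝ (Fin n))
    {mΩ : MeasurableSpace Ω} (P : Measure Ω) (ℱ : Filtration ℕ mΩ)
    (x : ℕ → Ω → R → EuclideanSpace ℝ (Fin n)) : Prop :=
  (∀ ω, x 0 ω = x0) ∧ (∀ k i, Measurable[ℱ k] (fun ω => x k ω i)) ∧
  ∃ (p : R → ℝ) (s : ℕ → Ω → (i : R) → Fin (pb.q i)) (c : ℕ → Ω → R → Bool)
    (z : ℕ → Ω → R → B → EuclideanSpace ℝ (Fin n)),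
    (∀ i, 1 / (pb.qmax : ℝ) ≤ p i ∧ p i ≤ 1 / (pb.qmin : ℝ)) ∧
    UniformDraws pb P ℱ s ∧ BernoulliTriggers P ℱ p c ∧
    ∀ ω, IsProxDBROPath pb.g Gr a φ α
      (pb.lsvrgEstimator (fun k => x k ω) (fun k => s k ω) (fun k => c k ω))
      (fun k => z k ω) (fun k => x k ω)

/-- The squared Euclidean distance `‖x - 1 ⊗ xs‖²` of the stacked state to consensus at `xs`. -/
def sqDist {R : Type*} [Fintype R] {n : ℕ} (x : R → EuclideanSpace ℝ (Fin n))
    (xs : EuclideanSpace ℝ (Fin n)) : ℝ := ∑ i, ‖x i - xs‖ ^ 2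

end

/-! Both algorithms are one scheme: a proximal step along a variance-reduced gradient estimate whose
stored points are refreshed, independently of the past, with probability between 1/qmax and 1/qmin
(`IsVarianceReduced`). The proof combines a pathwise inequality for one step with an induction on
expectations.

One step (`IsProxDBROPath.sqDist_succ_le`). Let v_i = ∇f_i(xs), and let g0 be minus the mean of the
v_i. Optimality puts g0 in ∂g(xs), so xs is the prox of xs + α g0. Nonexpansiveness then bounds the
new error by the norm of x_i - xs - α((r_i - v_i) + F_i), where F_i = (v_i + g0) + φ p_i + φ b_i
collects heterogeneity, penalty and attack. Subgradients of an a-norm have Euclidean norm at most √n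
whatever message was received, so ‖b_i‖ ≤ |B|√n: any number of attackers costs only a bounded force.
The penalty, paired with x - xs, yields at least S, the sum of ‖x_i - x_j‖_a over the reliable
edges. The heterogeneity v_i + g0 is the deviation from its mean of W_i = v_i + g', whose entries
are at most φ/|R|. By connectivity its pairing is at least -(1 - 1/|R|) φ n^(1-1/a) S. If n^(1-1/a)
≤ |R|/(|R|-1), the penalty absorbs it. Otherwise the penalty is dropped, and a sharper dual-norm
bound on b_i leaves room for the heterogeneity up to a factor 5/4 in the square
(`neg_two_mul_sum_inner_force_le`).

Expectation. Let V be the expected squared error and T that of the stored points. Components f_i^l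
need not be convex, so T measures distances rather than Bregman divergences. Unbiasedness, strong
monotonicity and Lipschitz gradients give V' ≤ (1 - 2μα + 5γα/4 + 4α²L²)V + 4α²L²T + noise and T' ≤
(1 - 1/qmax)T + V/qmin. Any Z obeying the recursion with rate γα/4, and decaying no faster than 1 -
1/(4 qmax) per step, dominates V (`expected_sqDist_le`). The two rates are two choices of Z:
geometric plus constant, and Ξ/(k+ξ) plus constant. -/

/-! ### The `a`-norm and its subgradients -/

section ANorm

variable {n : ℕ} {a : ℝ}

theorem aNorm_nonneg (v : EuclideanSpace ℝ (Fin n)) : 0 ≤ aNorm a v :=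
  Real.rpow_nonneg (Finset.sum_nonneg fun _ _ => Real.rpow_nonneg (abs_nonneg _) _) _

theorem aNorm_zero (ha : 1 ≤ a) : aNorm a (0 : EuclideanSpace ℝ (Fin n)) = 0 := by
  have h0 : a ≠ 0 := by positivity
  simp [aNorm, Real.zero_rpow h0, Real.zero_rpow (inv_ne_zero h0)]

theorem aNorm_neg (v : EuclideanSpace ℝ (Fin n)) : aNorm a (-v) = aNorm a v := by
  simp [aNorm]

theorem aNorm_sub_comm (v w : EuclideanSpace ℝ (Fin n)) : aNorm a (v - w) = aNorm a (w - v) := by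
  rw [← neg_sub, aNorm_neg]

theorem aNorm_add_le (ha : 1 ≤ a) (v w : EuclideanSpace ℝ (Fin n)) :
    aNorm a (v + w) ≤ aNorm a v + aNorm a w := by
  simpa [aNorm] using Real.Lp_add_le Finset.univ (fun e => v e) (fun e => w e) ha

/-- By the triangle inequality a subgradient has dual norm at most one. The bound does not see `z`,
which is what makes arbitrary Byzantine messages harmless. -/
theorem inner_le_aNorm_of_subgradient (ha : 1 ≤ a) {x z e : EuclideanSpace ℝ (Fin n)}
    (he : e ∈ subdifferential (fun y => aNorm a (y - z)) x) (v : EuclideanSpace ℝ (Fin n)) :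
    inner ℝ e v ≤ aNorm a v := by
  have h := he (x + v)
  have h2 := aNorm_add_le ha (x - z) v
  simp only [add_sub_cancel_left] at h
  rw [show x + v - z = x - z + v by abel] at h
  linarith

theorem aNorm_le_inner_of_subgradient (ha : 1 ≤ a) {x z e : EuclideanSpace ℝ (Fin n)}
    (he : e ∈ subdifferential (fun y => aNorm a (y - z)) x) :
    aNorm a (x - z) ≤ inner ℝ e (x - z) := by
  have h := he z
  simp only [sub_self, aNorm_zero ha] at h
  rw [← neg_sub x z, inner_neg_right] at h
  linarith

theorem aNorm_rpow (ha : 1 ≤ a) (v : EuclideanSpace ℝ (Fin n)) :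
    aNorm a v ^ a = ∑ e, |v e| ^ a := by
  rw [aNorm, ← Real.rpow_mul (Finset.sum_nonneg fun _ _ => Real.rpow_nonneg (abs_nonneg _) _),
    one_div, inv_mul_cancel₀ (by positivity), Real.rpow_one]

/-- Power mean inequality. It converts max-norm bounds on gradients into bounds against the a-norm
penalty. -/
theorem sum_abs_le_aNorm (ha : 1 ≤ a) (v : EuclideanSpace ℝ (Fin n)) :
    ∑ e, |v e| ≤ (n : ℝ) ^ (1 - 1 / a) * aNorm a v := by
  have ha0 : 0 < a := by positivity
  have h := Real.rpow_sum_le_const_mul_sum_rpow Finset.univ (fun e => v e) ha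
  simp only [Finset.card_univ, Fintype.card_fin] at h
  rw [← aNorm_rpow ha] at h
  rw [← Real.rpow_le_rpow_iff (Finset.sum_nonneg fun _ _ => abs_nonneg _)
    (mul_nonneg (by positivity) (aNorm_nonneg v)) ha0,
    Real.mul_rpow (by positivity) (aNorm_nonneg v), ← Real.rpow_mul (by positivity)]
  rwa [show (1 - 1 / a) * a = a - 1 by field_simp]

theorem abs_inner_le_sum {W v : EuclideanSpace ℝ (Fin n)} {M : ℝ} (hW : ∀ c, |W c| ≤ M) :
    |inner ℝ W v| ≤ M * ∑ c, |v c| := by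
  rw [PiLp.inner_apply, Finset.mul_sum]
  refine (Finset.abs_sum_le_sum_abs _ _).trans (Finset.sum_le_sum fun c _ => ?_)
  simp only [RCLike.inner_apply, conj_trivial, abs_mul]
  rw [mul_comm]
  exact mul_le_mul_of_nonneg_right (hW c) (abs_nonneg _)

theorem norm_sq_le_of_abs_le {W : EuclideanSpace ℝ (Fin n)} {M : ℝ} (hW : ∀ c, |W c| ≤ M) :
    ‖W‖ ^ 2 ≤ n * M ^ 2 := by
  rw [EuclideanSpace.norm_sq_eq]
  calc ∑ c, ‖W c‖ ^ 2 ≤ ∑ _c : Fin n, M ^ 2 :=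
        Finset.sum_le_sum fun c _ => pow_le_pow_left₀ (norm_nonneg _) (hW c) 2
    _ = n * M ^ 2 := by simp

theorem aNorm_le_norm (ha : 2 ≤ a) (v : EuclideanSpace ℝ (Fin n)) : aNorm a v ≤ ‖v‖ := by
  have ha0 : 0 < a := by positivity
  rw [← Real.rpow_le_rpow_iff (aNorm_nonneg v) (norm_nonneg v) ha0, aNorm_rpow (by linarith)]
  have hc : ∀ c, |v c| ≤ ‖v‖ := fun c => PiLp.norm_apply_le v c
  calc ∑ c, |v c| ^ a ≤ ∑ c, ‖v‖ ^ (a - 2) * ‖v c‖ ^ 2 := by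
        refine Finset.sum_le_sum fun c _ => ?_
        have : |v c| ^ a = |v c| ^ (a - 2) * ‖v c‖ ^ 2 := by
          rw [Real.norm_eq_abs, ← Real.rpow_natCast, ← Real.rpow_add_of_nonneg (abs_nonneg _)
            (by linarith) (by norm_num)]
          norm_num
        rw [this]
        exact mul_le_mul_of_nonneg_right
          (Real.rpow_le_rpow (abs_nonneg _) (hc c) (by linarith)) (by positivity)
    _ = ‖v‖ ^ a := by
        rw [← Finset.mul_sum, ← EuclideanSpace.norm_sq_eq, ← Real.rpow_natCast,
          ← Real.rpow_add_of_nonneg (norm_nonneg _) (by linarith) (by norm_num)]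
        norm_num

theorem aNorm_sq_le (ha : 1 ≤ a) (ha2 : a ≤ 2) (v : EuclideanSpace ℝ (Fin n)) :
    aNorm a v ^ 2 ≤ (n : ℝ) ^ (2 / a - 1) * ‖v‖ ^ 2 := by
  have ha0 : 0 < a := by positivity
  have h := Real.rpow_sum_le_const_mul_sum_rpow Finset.univ (fun e => |v e| ^ a)
    (p := 2 / a) ((one_le_div ha0).2 ha2)
  simp only [Finset.card_univ, Fintype.card_fin,
    abs_of_nonneg (Real.rpow_nonneg (abs_nonneg _) a)] at h
  rw [← aNorm_rpow ha, ← Real.rpow_mul (aNorm_nonneg v)] at h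
  have h2 : a * (2 / a) = (2 : ℕ) := by field_simp; norm_num
  simp only [← Real.rpow_mul (abs_nonneg _), h2, Real.rpow_natCast] at h
  rw [EuclideanSpace.norm_sq_eq]
  simpa using h

/-- A vector of dual `a`-norm at most one has Euclidean norm at most `1` or `√n / n ^ (1 - 1 / a)`.
-/
theorem norm_le_of_inner_le_aNorm (ha : 1 ≤ a) (hn : 1 ≤ n) {e : EuclideanSpace ℝ (Fin n)}
    (he : ∀ v, inner ℝ e v ≤ aNorm a v) : ‖e‖ ≤ max 1 (√n / (n : ℝ) ^ (1 - 1 / a)) := by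
  have ha0 : 0 < a := by positivity
  have hn0 : (0 : ℝ) < n := by exact_mod_cast hn
  have h := he e
  rw [real_inner_self_eq_norm_sq] at h
  have he0 := norm_nonneg e
  rcases eq_or_lt_of_le he0 with h0 | hpos
  · rw [← h0]; positivity
  -- Testing `he` on `e` itself gives ‖e‖² ≤ ‖e‖_a. For a ≥ 2 the a-norm is at most the Euclidean
  -- norm; for a ≤ 2 the comparison costs n^(1/a - 1/2), which is the second entry of the maximum.
  rcases le_total 2 a with h2 | h2
  · refine le_max_of_le_left ?_
    have := aNorm_le_norm h2 e
    nlinarith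
  · refine le_max_of_le_right ?_
    have h3 := aNorm_sq_le ha h2 e
    have h4 : ‖e‖ ^ 2 ≤ (n : ℝ) ^ (2 / a - 1) := by
      have : ‖e‖ ^ 2 * ‖e‖ ^ 2 ≤ (n : ℝ) ^ (2 / a - 1) * ‖e‖ ^ 2 := by
        refine le_trans ?_ h3
        rw [← sq]
        exact pow_le_pow_left₀ (by positivity) h 2
      exact le_of_mul_le_mul_right this (by positivity)
    refine le_of_sq_le_sq (h4.trans_eq ?_) (by positivity)
    rw [div_pow, Real.sq_sqrt hn0.le, ← Real.rpow_natCast, ← Real.rpow_mul hn0.le]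
    conv_rhs => rw [← Real.rpow_one (n : ℝ), ← Real.rpow_mul hn0.le, ← Real.rpow_sub hn0]
    congr 1
    push_cast
    field_simp
    ring

theorem one_le_card_rpow (ha : 1 ≤ a) (hn : 1 ≤ n) : 1 ≤ (n : ℝ) ^ (1 - 1 / a) := by
  refine Real.one_le_rpow (by exact_mod_cast hn) ?_
  rw [sub_nonneg, div_le_one (by positivity)]
  exact ha

theorem card_rpow_le (ha : 1 ≤ a) (hn : 1 ≤ n) : (n : ℝ) ^ (1 - 1 / a) ≤ n := by
  conv_rhs => rw [← Real.rpow_one (n : ℝ)]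
  refine Real.rpow_le_rpow_of_exponent_le (by exact_mod_cast hn) ?_
  have : 0 ≤ 1 / a := by positivity
  linarith

theorem norm_le_sqrt_of_inner_le_aNorm (ha : 1 ≤ a) (hn : 1 ≤ n) {e : EuclideanSpace ℝ (Fin n)}
    (he : ∀ v, inner ℝ e v ≤ aNorm a v) : ‖e‖ ≤ √n := by
  refine (norm_le_of_inner_le_aNorm ha hn he).trans (max_le ?_ ?_)
  · rw [Real.one_le_sqrt]; exact_mod_cast hn
  · exact div_le_self (Real.sqrt_nonneg _) (one_le_card_rpow ha hn)

end ANorm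

/-! ### Convex minimization -/

section Prox

variable {n : ℕ} {g : EuclideanSpace ℝ (Fin n) → ℝ}

theorem nonneg_of_forall_add_mul_nonneg {c d : ℝ} (h : ∀ t : ℝ, 0 < t → t ≤ 1 → 0 ≤ c + t * d) :
    0 ≤ c := by
  by_contra! hc
  have hd : 0 < d := by have := h 1 one_pos le_rfl; linarith
  have ht : 0 < -c / (2 * d) := by apply div_pos <;> linarith
  have := h (min 1 (-c / (2 * d))) (by positivity) (min_le_left _ _)
  have h2 : min 1 (-c / (2 * d)) * d ≤ -c / (2 * d) * d :=
    mul_le_mul_of_nonneg_right (min_le_right _ _) hd.le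
  have h3 : -c / (2 * d) * d = -c / 2 := by field_simp
  linarith

theorem convexOn_segment (hg : ConvexOn ℝ Set.univ g) (x y : EuclideanSpace ℝ (Fin n)) {t : ℝ}
    (h0 : 0 ≤ t) (h1 : t ≤ 1) : g (x + t • (y - x)) ≤ g x + t * (g y - g x) := by
  have := hg.2 (Set.mem_univ x) (Set.mem_univ y) (sub_nonneg.2 h1) h0 (by ring)
  rw [show (1 - t) • x + t • y = x + t • (y - x) by module] at this
  simp only [smul_eq_mul] at this
  linarith

/-- First-order optimality, (X - p)/α ∈ ∂g(p): compare p with p + t(y - p), divide by t and let t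
tend to 0. -/
theorem IsProx.subgradient {α : ℝ} (hg : ConvexOn ℝ Set.univ g)
    {X p : EuclideanSpace ℝ (Fin n)} (hp : IsProx α g X p) (y : EuclideanSpace ℝ (Fin n)) :
    g p + 1 / α * inner ℝ (X - p) (y - p) ≤ g y := by
  have key : 0 ≤ g y - g p - 1 / α * inner ℝ (X - p) (y - p) := by
    refine nonneg_of_forall_add_mul_nonneg (d := 1 / (2 * α) * ‖y - p‖ ^ 2) fun t ht ht1 => ?_
    have h1 := hp (p + t • (y - p))
    have h2 := convexOn_segment hg p y ht.le ht1
    rw [show p + t • (y - p) - X = (p - X) + t • (y - p) by abel, norm_add_sq_real,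
      inner_smul_right, norm_smul, mul_pow, Real.norm_eq_abs, sq_abs, ← neg_sub X p,
      inner_neg_left, norm_neg] at h1
    have h3 : 1 / α = 2 * (1 / (2 * α)) := by rw [one_div, one_div, mul_inv]; ring
    rw [h3]
    refine nonneg_of_mul_nonneg_right ?_ ht
    nlinarith
  linarith

/-- Nonexpansiveness against the fixed point xs = prox(xs + α g0): monotonicity of ∂g, then
Cauchy–Schwarz. -/
theorem IsProx.norm_sub_le {α : ℝ} (hα : 0 < α) (hg : ConvexOn ℝ Set.univ g)
    {X p xs g0 : EuclideanSpace ℝ (Fin n)} (hp : IsProx α g X p)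
    (hg0 : g0 ∈ subdifferential g xs) : ‖p - xs‖ ≤ ‖X - xs - α • g0‖ := by
  have h1 := hp.subgradient hg xs
  have h2 := hg0 p
  have h3 : 0 ≤ inner ℝ (X - p - α • g0) (p - xs) := by
    rw [inner_sub_left, inner_smul_left, conj_trivial]
    rw [← neg_sub p xs, inner_neg_right] at h1
    have h4 : α * inner ℝ g0 (p - xs) ≤ α * (1 / α * inner ℝ (X - p) (p - xs)) :=
      mul_le_mul_of_nonneg_left (by linarith) hα.le
    rw [← mul_assoc, mul_one_div_cancel hα.ne', one_mul] at h4
    linarith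
  have h5 : ‖p - xs‖ ^ 2 ≤ inner ℝ (X - xs - α • g0) (p - xs) := by
    rw [show X - p - α • g0 = (X - xs - α • g0) - (p - xs) by abel, inner_sub_left,
      real_inner_self_eq_norm_sq] at h3
    linarith
  have h6 := real_inner_le_norm (X - xs - α • g0) (p - xs)
  rcases eq_or_lt_of_le (norm_nonneg (p - xs)) with h0 | hpos
  · rw [← h0]; positivity
  · nlinarith

end Prox

/-! ### Local objectives -/

section Objective

variable {R : Type*} {n : ℕ} {pb : CompositeProblem R n} {μi : R → ℝ}
  {Lil : (i : R) → Fin (pb.q i) → ℝ}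

namespace CompositeProblem.ConvexSmooth

theorem hasGradientAt (h : pb.ConvexSmooth μi Lil) (i : R) (l : Fin (pb.q i))
    (y : EuclideanSpace ℝ (Fin n)) : HasGradientAt (pb.f i l) (gradient (pb.f i l) y) y :=
  (h.differentiable i l y).hasGradientAt

theorem hasGradientAt_localObj (h : pb.ConvexSmooth μi Lil) (i : R)
    (y : EuclideanSpace ℝ (Fin n)) : HasGradientAt (pb.localObj i)
      ((1 / (pb.q i : ℝ)) • ∑ l, gradient (pb.f i l) y) y := by
  rw [hasGradientAt_iff_hasFDerivAt]
  have h1 := HasFDerivAt.fun_sum (u := Finset.univ)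
    fun l _ => (hasGradientAt_iff_hasFDerivAt.1 (h.hasGradientAt i l y))
  have h2 := h1.const_mul (1 / (pb.q i : ℝ))
  convert! h2 using 1
  · ext z; simp only [CompositeProblem.localObj]; ring
  · simp [map_sum]

theorem gradient_localObj (h : pb.ConvexSmooth μi Lil) (i : R) (y : EuclideanSpace ℝ (Fin n)) :
    gradient (pb.localObj i) y = (1 / (pb.q i : ℝ)) • ∑ l, gradient (pb.f i l) y :=
  (h.hasGradientAt_localObj i y).gradient

theorem hasDerivAt_segment (h : pb.ConvexSmooth μi Lil) (i : R) (x d : EuclideanSpace ℝ (Fin n))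
    (t : ℝ) : HasDerivAt (fun t : ℝ => pb.localObj i (x + t • d))
      (inner ℝ (gradient (pb.localObj i) (x + t • d)) d) t := by
  have h1 := (hasGradientAt_iff_hasFDerivAt.1 (h.hasGradientAt_localObj i (x + t • d)))
  rw [← h.gradient_localObj] at h1
  have h2 : HasDerivAt (fun t : ℝ => x + t • d) d t := by
    simpa using ((hasDerivAt_id t).smul_const d).const_add x
  exact h1.comp_hasDerivAt t h2

/-- The Bregman divergence of a local objective is nonnegative. -/
theorem bregman_nonneg (h : pb.ConvexSmooth μi Lil) (i : R) (x y : EuclideanSpace ℝ (Fin n)) :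
    0 ≤ pb.localObj i y - pb.localObj i x - inner ℝ (gradient (pb.localObj i) x) (y - x) := by
  set d := y - x
  have hd : ∀ t, HasDerivAt (fun t : ℝ => pb.localObj i (x + t • d)
      - t * inner ℝ (gradient (pb.localObj i) x) d)
      (inner ℝ (gradient (pb.localObj i) (x + t • d)) d
        - inner ℝ (gradient (pb.localObj i) x) d) t := fun t => by
    simpa only [one_mul, id] using
      (h.hasDerivAt_segment i x d t).fun_sub ((hasDerivAt_id t).mul_const _)
  have hmono : MonotoneOn (fun t : ℝ => pb.localObj i (x + t • d)
      - t * inner ℝ (gradient (pb.localObj i) x) d) (Set.Icc 0 1) := by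
    refine monotoneOn_of_deriv_nonneg (convex_Icc 0 1)
      (fun t _ => (hd t).continuousAt.continuousWithinAt)
      (fun t _ => (hd t).differentiableAt.differentiableWithinAt) fun t ht => ?_
    rw [interior_Icc] at ht
    rw [(hd t).deriv, ← inner_sub_left]
    have h1 := h.strong i (x + t • d) x
    rw [add_sub_cancel_left, inner_smul_right] at h1
    have h2 : 0 ≤ μi i * ‖t • d‖ ^ 2 := mul_nonneg (h.mu_pos i).le (by positivity)
    exact nonneg_of_mul_nonneg_right (h2.trans h1) ht.1
  have := hmono (Set.left_mem_Icc.2 zero_le_one) (Set.right_mem_Icc.2 zero_le_one) zero_le_one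
  simp only [zero_smul, add_zero, zero_mul, sub_zero, one_smul, one_mul] at this
  rw [show x + d = y by simp [d]] at this
  linarith

/-- With all stored points of an agent equal, the average over components is the Bregman divergence
of the convex `localObj i`, so no convexity of components is needed. This gives t₀ ≥ 0. -/
theorem gradLearn_const_nonneg [Fintype R] (h : pb.ConvexSmooth μi Lil)
    (xs : EuclideanSpace ℝ (Fin n)) (x0 : R → EuclideanSpace ℝ (Fin n)) :
    0 ≤ pb.gradLearn xs (fun i _ => x0 i) := by
  refine Finset.sum_nonneg fun i _ => ?_
  have h1 := h.bregman_nonneg i xs (x0 i)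
  rw [h.gradient_localObj, inner_smul_left, sum_inner] at h1
  convert! h1 using 1
  simp only [CompositeProblem.localObj, Finset.sum_sub_distrib, conj_trivial]
  ring

theorem continuous_gradient (h : pb.ConvexSmooth μi Lil) (i : R) (l : Fin (pb.q i)) :
    Continuous (gradient (pb.f i l)) := by
  refine (LipschitzWith.of_dist_le_mul (K := (Lil i l).toNNReal) fun y z => ?_).continuous
  rw [dist_eq_norm, dist_eq_norm]
  exact (h.smooth i l y z).trans
    (mul_le_mul_of_nonneg_right (Real.le_coe_toNNReal _) (norm_nonneg _))

/-- Strong monotonicity and smoothness constants are ordered. -/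
theorem mu_le (h : pb.ConvexSmooth μi Lil) (hn : 1 ≤ n) {L : ℝ} (hL : ∀ i l, Lil i l ≤ L)
    (i : R) : μi i ≤ L := by
  obtain ⟨v, hv⟩ : ∃ v : EuclideanSpace ℝ (Fin n), v ≠ 0 :=
    ⟨EuclideanSpace.single ⟨0, hn⟩ 1, by simp⟩
  have hq : (0 : ℝ) < pb.q i := by exact_mod_cast pb.q_pos i
  have h1 := h.strong i v 0
  have h2 : ‖gradient (pb.localObj i) v - gradient (pb.localObj i) 0‖ ≤ L * ‖v‖ := by
    rw [h.gradient_localObj, h.gradient_localObj, ← smul_sub, ← Finset.sum_sub_distrib, norm_smul]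
    have : ‖∑ l, (gradient (pb.f i l) v - gradient (pb.f i l) 0)‖ ≤ ∑ _l : Fin (pb.q i), L * ‖v‖ :=
      norm_sum_le_of_le _ fun l _ => by
        have := h.smooth i l v 0
        rw [sub_zero] at this
        exact this.trans (mul_le_mul_of_nonneg_right (hL i l) (norm_nonneg _))
    rw [Finset.sum_const, Finset.card_univ, Fintype.card_fin, nsmul_eq_mul] at this
    rw [Real.norm_of_nonneg (by positivity), one_div, inv_mul_le_iff₀ hq]
    exact this
  have h3 := real_inner_le_norm (gradient (pb.localObj i) v - gradient (pb.localObj i) 0) (v - 0)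
  have h4 := mul_le_mul_of_nonneg_right h2 (norm_nonneg v)
  rw [sub_zero] at h1 h3
  have hv0 : 0 < ‖v‖ ^ 2 := by positivity
  nlinarith

/-- At the optimum, minus the mean of the local gradients is a subgradient of `g`. -/
theorem neg_mean_gradient_mem [Fintype R] [Nonempty R] (h : pb.ConvexSmooth μi Lil)
    {xs : EuclideanSpace ℝ (Fin n)} (hxs : pb.IsOptimal xs) :
    -((1 / (Fintype.card R : ℝ)) • ∑ i, gradient (pb.localObj i) xs)
      ∈ subdifferential pb.g xs := by
  intro z
  have hR : (0 : ℝ) < Fintype.card R := by exact_mod_cast Fintype.card_pos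
  have hderiv : HasDerivAt (fun t : ℝ => ∑ i, pb.localObj i (xs + t • (z - xs)))
      (∑ i, inner ℝ (gradient (pb.localObj i) xs) (z - xs)) 0 := by
    have := HasDerivAt.fun_sum (u := Finset.univ)
      fun i _ => h.hasDerivAt_segment i xs (z - xs) 0
    simpa using this
  have hslope := (hasDerivAt_iff_tendsto_slope.1 hderiv).mono_left
    (nhdsWithin_mono (0 : ℝ) (fun t (ht : t ∈ Set.Ioi (0 : ℝ)) => ne_of_gt ht))
  -- For 0 < t ≤ 1, optimality of xs and convexity of g along the segment bound the slope of the
  -- smooth part from below; then t tends to 0.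
  have hbound : -(Fintype.card R * (pb.g z - pb.g xs))
      ≤ ∑ i, inner ℝ (gradient (pb.localObj i) xs) (z - xs) := by
    refine ge_of_tendsto hslope ?_
    filter_upwards [Ioc_mem_nhdsGT (zero_lt_one' ℝ)] with t ht
    have h1 := hxs (xs + t • (z - xs))
    have h2 := convexOn_segment h.convex_g xs z ht.1.le ht.2
    simp only [Finset.sum_add_distrib, Finset.sum_const, Finset.card_univ, nsmul_eq_mul] at h1
    have h3 := mul_le_mul_of_nonneg_left h2 hR.le
    rw [slope_def_field, sub_zero, le_div_iff₀ ht.1]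
    simp only [zero_smul, add_zero]
    linarith
  rw [inner_neg_left, inner_smul_left, sum_inner, conj_trivial]
  have h5 : 1 / (Fintype.card R : ℝ) * -(Fintype.card R * (pb.g z - pb.g xs))
      ≤ 1 / (Fintype.card R : ℝ) * ∑ i, inner ℝ (gradient (pb.localObj i) xs) (z - xs) :=
    mul_le_mul_of_nonneg_left hbound (by positivity)
  have h6 : 1 / (Fintype.card R : ℝ) * -(Fintype.card R * (pb.g z - pb.g xs))
      = -(pb.g z - pb.g xs) := by field_simp
  linarith

end CompositeProblem.ConvexSmooth

end Objective

/-! ### Edge sums and the incidence matrix -/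

section Graph

variable {R : Type*} [Fintype R] (H : SimpleGraph R)

open Classical in
theorem sum_adj_eq_two_mul_sum_edgeFinset (F : Sym2 R → ℝ) :
    ∑ i, ∑ j with H.Adj i j, F s(i, j) = 2 * ∑ e ∈ H.edgeFinset, F e := by
  have h1 : ∑ i, ∑ j with H.Adj i j, F s(i, j)
      = ∑ p : R × R with H.Adj p.1 p.2, F s(p.1, p.2) := by
    rw [Finset.sum_filter, Fintype.sum_prod_type]
    simp only [Finset.sum_filter]
  rw [h1, ← Finset.sum_fiberwise_of_maps_to (t := H.edgeFinset) (g := fun p : R × R => s(p.1, p.2))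
    (by simp), Finset.mul_sum]
  refine Finset.sum_congr rfl fun e he => ?_
  induction e with
  | _ i j =>
    have hij : H.Adj i j := by simpa using he
    have : ({p ∈ ({p : R × R | H.Adj p.1 p.2} : Finset (R × R)) | s(p.1, p.2) = s(i, j)})
        = {(i, j), (j, i)} := by
      ext ⟨k, l⟩
      simp only [Finset.mem_filter, Finset.mem_univ, true_and, Finset.mem_insert,
        Finset.mem_singleton, Prod.mk.injEq, Sym2.eq_iff]
      constructor
      · exact fun h => h.2
      · rintro (⟨rfl, rfl⟩ | ⟨rfl, rfl⟩)
        · exact ⟨hij, Or.inl ⟨rfl, rfl⟩⟩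
        · exact ⟨hij.symm, Or.inr ⟨rfl, rfl⟩⟩
    rw [this, Finset.sum_pair (by simp [hij.ne]), Sym2.eq_swap (a := j)]
    ring

open Classical in
/-- In a connected graph, a symmetric function satisfying the triangle inequality is bounded by
its sum over the edges. -/
theorem le_half_sum_adj (hH : H.Connected) {F : R → R → ℝ} (hF0 : ∀ i, F i i = 0)
    (hFnn : ∀ i j, 0 ≤ F i j) (hFsymm : ∀ i j, F i j = F j i)
    (hFtri : ∀ i j k, F i k ≤ F i j + F j k) (u v : R) :
    F u v ≤ (∑ i, ∑ j with H.Adj i j, F i j) / 2 := by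
  set G : Sym2 R → ℝ := Sym2.lift ⟨F, hFsymm⟩
  have hG : ∀ i j, G s(i, j) = F i j := fun i j => rfl
  have hGnn : ∀ e, 0 ≤ G e := fun e => by
    induction e with
    | _ i j => exact hFnn i j
  have hwalk : ∀ {u v : R} (p : H.Walk u v), F u v ≤ (p.edges.map G).sum := by
    intro u v p
    induction p with
    | nil => simp [hF0]
    | cons h p ih =>
      rw [SimpleGraph.Walk.edges_cons, List.map_cons, List.sum_cons, hG]
      exact (hFtri _ _ _).trans (add_le_add_right ih _)
  obtain ⟨p⟩ := hH.preconnected u v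
  -- A path uses each edge at most once, so its length is at most the sum over all edges.
  have hnodup : (p.toPath : H.Walk u v).edges.Nodup := p.toPath.2.isTrail.edges_nodup
  have hsum := sum_adj_eq_two_mul_sum_edgeFinset H G
  simp only [hG] at hsum
  rw [hsum, mul_div_cancel_left₀ _ two_ne_zero]
  refine (hwalk (p.toPath : H.Walk u v)).trans ?_
  rw [← List.sum_toFinset _ hnodup]
  refine Finset.sum_le_sum_of_subset_of_nonneg (fun e he => ?_) fun e _ _ => hGnn e
  rw [SimpleGraph.mem_edgeFinset]
  exact SimpleGraph.Walk.edges_subset_edgeSet _ (List.mem_toFinset.1 he)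

variable [LinearOrder R]

theorem sum_incidence_mul (u : R → ℝ) (e : H.edgeSet) :
    ∑ i, incidence H i e * u i = u (e : Sym2 R).inf - u (e : Sym2 R).sup := by
  obtain ⟨e, he⟩ := e
  have hne : e.inf ≠ e.sup := by
    induction e with
    | _ i j =>
      have hij : i ≠ j := H.ne_of_adj he
      simpa using hij
  have : ∀ i, incidence H i ⟨e, he⟩ * u i
      = (if i = e.inf then u i else 0) - if i = e.sup then u i else 0 := by
    intro i
    simp only [incidence]
    split_ifs with h1 h2
    · exact absurd (h1.symm.trans h2) hne
    all_goals simp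
  simp only [this, Finset.sum_sub_distrib, Finset.sum_ite_eq', Finset.mem_univ, if_true]

/-- The Laplacian form of a graph is at most that of the complete graph, which is |R| ∑ u_i² - (∑
u_i)². -/
theorem sum_sq_edge_le [Fintype H.edgeSet] (u : R → ℝ) :
    ∑ e : H.edgeSet, (u (e : Sym2 R).inf - u (e : Sym2 R).sup) ^ 2
      ≤ Fintype.card R * ∑ i, u i ^ 2 := by
  classical
  have h2 := sum_adj_eq_two_mul_sum_edgeFinset H fun e => (u e.inf - u e.sup) ^ 2
  have h3 : ∀ i j, (u s(i, j).inf - u s(i, j).sup) ^ 2 = (u i - u j) ^ 2 := by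
    intro i j
    rcases le_total i j with h | h
    · simp [h]
    · simp [h]; ring
  simp only [h3] at h2
  have h4 : ∑ i, ∑ j with H.Adj i j, (u i - u j) ^ 2 ≤ ∑ i, ∑ j, (u i - u j) ^ 2 :=
    Finset.sum_le_sum fun i _ => Finset.sum_le_sum_of_subset_of_nonneg (Finset.filter_subset _ _)
      fun _ _ _ => sq_nonneg _
  have h5 : ∑ i, ∑ j, (u i - u j) ^ 2
      = 2 * (Fintype.card R * ∑ i, u i ^ 2) - 2 * (∑ i, u i) ^ 2 := by
    simp only [sub_sq, Finset.sum_add_distrib, Finset.sum_sub_distrib, Finset.sum_const,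
      Finset.card_univ, nsmul_eq_mul, ← Finset.mul_sum, ← Finset.sum_mul]
    ring
  have h6 := sq_nonneg (∑ i, u i)
  rw [Finset.sum_subtype (p := (· ∈ H.edgeSet)) _ (fun e => by simp)] at h2
  linarith

theorem singularValues_incidence_le [Fintype H.edgeSet] (j : ℕ) :
    (Matrix.toEuclideanLin (incidence H)).singularValues j ≤ √(Fintype.card R) := by
  classical
  set T := Matrix.toEuclideanLin (incidence H)
  -- Beyond the dimension of the domain `singularValues` takes the default value 0.
  by_cases hj : Module.finrank ℝ (EuclideanSpace ℝ H.edgeSet) ≤ j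
  · rw [T.singularValues_of_finrank_le hj]; positivity
  obtain ⟨w, hw⟩ := (T.hasEigenvalue_adjoint_comp_self_sq_singularValues
    (not_le.1 hj)).exists_hasEigenvector
  set σ := T.singularValues j
  have hadj : ∀ x : EuclideanSpace ℝ R, ‖T.adjoint x‖ ^ 2 ≤ Fintype.card R * ‖x‖ ^ 2 := by
    intro x
    rw [EuclideanSpace.norm_sq_eq, EuclideanSpace.norm_sq_eq]
    simp only [Real.norm_eq_abs, sq_abs]
    refine le_trans (le_of_eq (Finset.sum_congr rfl fun e _ => ?_)) (sum_sq_edge_le H x)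
    rw [← sum_incidence_mul, ← Matrix.toEuclideanLin_conjTranspose_eq_adjoint]
    simp [Matrix.toLpLin_apply, Matrix.mulVec, dotProduct]
  have happly : T.adjoint (T w) = σ ^ 2 • w := hw.apply_eq_smul
  have h1 := hadj (T w)
  have h2 : ‖T w‖ ^ 2 = σ ^ 2 * ‖w‖ ^ 2 := by
    rw [← real_inner_self_eq_norm_sq, ← LinearMap.adjoint_inner_left, happly, inner_smul_left,
      real_inner_self_eq_norm_sq, conj_trivial]
  rw [happly, h2, norm_smul, mul_pow, Real.norm_eq_abs, sq_abs] at h1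
  have hw0 : 0 < ‖w‖ ^ 2 := by have := norm_pos_iff.2 hw.2; positivity
  refine Real.le_sqrt_of_sq_le ?_
  rcases eq_or_lt_of_le (sq_nonneg σ) with h0 | h0
  · rw [← h0]; positivity
  · have : σ ^ 2 * (σ ^ 2 * ‖w‖ ^ 2) ≤ Fintype.card R * (σ ^ 2 * ‖w‖ ^ 2) := by linarith
    exact le_of_mul_le_mul_right this (by positivity)

/-- An edge makes the matrix nonzero, so the set of positive singular values is nonempty and finite
and its infimum is attained. The upper bound √|R| turns the threshold on φ into a usable inequality.
-/
theorem minSingularValue_incidence [Fintype H.edgeSet] (hE : H.edgeSet.Nonempty) :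
    0 < minSingularValue (incidence H) ∧ minSingularValue (incidence H) ≤ √(Fintype.card R) := by
  set T := Matrix.toEuclideanLin (incidence H) with hT
  have hT0 : T ≠ 0 := by
    obtain ⟨e, he⟩ := hE
    intro h
    have h1 : incidence H = 0 := by
      rwa [hT, LinearEquiv.map_eq_zero_iff] at h
    have h2 := congrFun (congrFun h1 e.inf) ⟨e, he⟩
    simp [incidence] at h2
  have hpos : 0 < T.singularValues 0 := by
    rw [T.singularValues_pos_iff_lt_finrank_range, Nat.pos_iff_ne_zero, ne_eq,
      Submodule.finrank_eq_zero, LinearMap.range_eq_bot]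
    exact hT0
  set S := {σ : ℝ | 0 < σ ∧ ∃ j : ℕ, T.singularValues j = σ}
  have hS : minSingularValue (incidence H) = sInf S := by
    unfold minSingularValue
    simp only [S, T]
    congr!
  have hfin : S.Finite := by
    refine (T.singularValues.support.finite_toSet.image T.singularValues).subset ?_
    rintro σ ⟨hσ, j, rfl⟩
    exact ⟨j, Finsupp.mem_support_iff.2 hσ.ne', rfl⟩
  have hmem := Set.Nonempty.csInf_mem (s := S) ⟨_, hpos, 0, rfl⟩ hfin
  rw [hS]
  refine ⟨hmem.1, ?_⟩
  obtain ⟨j, hj⟩ := hmem.2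
  rw [← hj]
  exact singularValues_incidence_le H j

end Graph

/-! ### The penalty and the Byzantine forces -/

section Forces

variable {R : Type*} [Fintype R] {n : ℕ} {a : ℝ}

theorem norm_add_sq_le_weighted {E : Type*} [NormedAddCommGroup E] [InnerProductSpace ℝ E]
    (x y : E) {s : ℝ} (hs : 0 < s) :
    ‖x + y‖ ^ 2 ≤ (1 + s) * ‖x‖ ^ 2 + (1 + 1 / s) * ‖y‖ ^ 2 := by
  have h1 : ‖x + y‖ ^ 2 ≤ (‖x‖ + ‖y‖) ^ 2 := pow_le_pow_left₀ (norm_nonneg _) (norm_add_le x y) 2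
  have h2 : (1 + s) * ‖x‖ ^ 2 + (1 + 1 / s) * ‖y‖ ^ 2 - (‖x‖ + ‖y‖) ^ 2
      = (s * ‖x‖ - ‖y‖) ^ 2 / s := by
    field_simp
    ring
  have h3 : 0 ≤ (s * ‖x‖ - ‖y‖) ^ 2 / s := by positivity
  linarith

theorem norm_add_add_sq_le {E : Type*} [NormedAddCommGroup E] (x y z : E) :
    ‖x + y + z‖ ^ 2 ≤ 2 * ‖x‖ ^ 2 + 4 * ‖y‖ ^ 2 + 4 * ‖z‖ ^ 2 := by
  have h1 : ‖x + y + z‖ ^ 2 ≤ (‖x‖ + ‖y‖ + ‖z‖) ^ 2 :=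
    pow_le_pow_left₀ (norm_nonneg _) norm_add₃_le 2
  nlinarith [sq_nonneg (‖x‖ - ‖y‖ - ‖z‖), sq_nonneg (‖y‖ - ‖z‖)]

theorem sum_norm_sub_mean_sq_le {E ι : Type*} [NormedAddCommGroup E] [InnerProductSpace ℝ E]
    [Fintype ι] (W : ι → E) :
    ∑ i, ‖W i - (1 / (Fintype.card ι : ℝ)) • ∑ j, W j‖ ^ 2 ≤ ∑ i, ‖W i‖ ^ 2 := by
  simp only [norm_sub_sq_real, Finset.sum_add_distrib, Finset.sum_sub_distrib, Finset.sum_const,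
    Finset.card_univ, nsmul_eq_mul, inner_smul_right, norm_smul, ← Finset.mul_sum, ← sum_inner,
    real_inner_self_eq_norm_sq, mul_pow, Real.norm_eq_abs, sq_abs]
  rcases Nat.eq_zero_or_pos (Fintype.card ι) with h0 | h0
  · simp [h0]
  · have h0 : (0 : ℝ) < Fintype.card ι := by exact_mod_cast h0
    have : (Fintype.card ι : ℝ) * ((1 / (Fintype.card ι : ℝ)) ^ 2 * ‖∑ i, W i‖ ^ 2)
        = 1 / (Fintype.card ι : ℝ) * ‖∑ i, W i‖ ^ 2 := by field_simp
    rw [this]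
    have : 0 ≤ 1 / (Fintype.card ι : ℝ) * ‖∑ i, W i‖ ^ 2 := by positivity
    linarith

theorem neg_two_mul_sum_inner_le {E ι : Type*} [NormedAddCommGroup E] [InnerProductSpace ℝ E]
    [Fintype ι] (F y : ι → E) {c : ℝ} (hc : 0 < c) :
    -2 * ∑ i, inner ℝ (F i) (y i) ≤ c * ∑ i, ‖y i‖ ^ 2 + 1 / c * ∑ i, ‖F i‖ ^ 2 := by
  rw [Finset.mul_sum, Finset.mul_sum, Finset.mul_sum, ← Finset.sum_add_distrib]
  refine Finset.sum_le_sum fun i _ => ?_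
  have h1 := abs_le.1 (abs_real_inner_le_norm (F i) (y i))
  have h2 : c * ‖y i‖ ^ 2 + 1 / c * ‖F i‖ ^ 2 - 2 * (‖F i‖ * ‖y i‖)
      = (c * ‖y i‖ - ‖F i‖) ^ 2 / c := by
    field_simp
    ring
  have h3 : 0 ≤ (c * ‖y i‖ - ‖F i‖) ^ 2 / c := by positivity
  linarith

open Classical in
/-- The penalty forces along the reliable edges push towards consensus. -/
theorem penalty_le_sum_inner (H : SimpleGraph R) (ha : 1 ≤ a)
    {x : R → EuclideanSpace ℝ (Fin n)} {d : R → R → EuclideanSpace ℝ (Fin n)}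
    (hd : ∀ i j, H.Adj i j →
      d i j ∈ subdifferential (fun y => aNorm a (y - x j)) (x i) ∧ d j i = -d i j)
    (xs : EuclideanSpace ℝ (Fin n)) :
    (∑ i, ∑ j with H.Adj i j, aNorm a (x i - x j)) / 2
      ≤ ∑ i, inner ℝ (∑ j with H.Adj i j, d i j) (x i - xs) := by
  have h1 : ∑ i, inner ℝ (∑ j with H.Adj i j, d i j) (x i - xs)
      = ∑ i, ∑ j, if H.Adj i j then inner ℝ (d i j) (x i - xs) else 0 := by
    refine Finset.sum_congr rfl fun i _ => ?_
    rw [sum_inner, Finset.sum_filter]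
  -- Exchanging i and j and using antisymmetry gives a second form of the same sum; added to the
  -- first, each ordered pair contributes ⟨d i j, x i - x j⟩ and xs disappears.
  have h2 : ∑ i, inner ℝ (∑ j with H.Adj i j, d i j) (x i - xs)
      = ∑ i, ∑ j, if H.Adj i j then -inner ℝ (d i j) (x j - xs) else 0 := by
    rw [h1, Finset.sum_comm]
    refine Finset.sum_congr rfl fun i _ => Finset.sum_congr rfl fun j _ => ?_
    by_cases h : H.Adj i j
    · rw [if_pos h, if_pos h.symm, (hd i j h).2, inner_neg_left]
    · rw [if_neg h, if_neg fun h' => h h'.symm]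
  have h3 : ∑ i, ∑ j with H.Adj i j, aNorm a (x i - x j)
      ≤ ∑ i, ∑ j, ((if H.Adj i j then inner ℝ (d i j) (x i - xs) else 0)
        + if H.Adj i j then -inner ℝ (d i j) (x j - xs) else 0) := by
    refine Finset.sum_le_sum fun i _ => ?_
    rw [Finset.sum_filter]
    refine Finset.sum_le_sum fun j _ => ?_
    by_cases h : H.Adj i j
    · simp only [if_pos h]
      refine (aNorm_le_inner_of_subgradient ha (hd i j h).1).trans_eq ?_
      rw [← sub_eq_add_neg, ← inner_sub_right, sub_sub_sub_cancel_right]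
    · simp [if_neg h]
  simp only [Finset.sum_add_distrib] at h3
  rw [← h1, ← h2] at h3
  linarith

open Classical in
/-- The gradient heterogeneity is dominated by the edge penalty. -/
theorem sum_inner_sub_mean_ge (H : SimpleGraph R) (hH : H.Connected) (ha : 1 ≤ a)
    {M : ℝ} (hM : 0 ≤ M) {W : R → EuclideanSpace ℝ (Fin n)} (hW : ∀ i c, |W i c| ≤ M)
    (x : R → EuclideanSpace ℝ (Fin n)) (xs : EuclideanSpace ℝ (Fin n)) :
    -(((Fintype.card R : ℝ) - 1) * (M * (n : ℝ) ^ (1 - 1 / a)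
        * ((∑ i, ∑ j with H.Adj i j, aNorm a (x i - x j)) / 2)))
      ≤ ∑ i, inner ℝ (W i - (1 / (Fintype.card R : ℝ)) • ∑ j, W j) (x i - xs) := by
  have := hH.nonempty
  have hR : (0 : ℝ) < Fintype.card R := by exact_mod_cast Fintype.card_pos
  set S := (∑ i, ∑ j with H.Adj i j, aNorm a (x i - x j)) / 2
  have hS : ∀ i j, aNorm a (x i - x j) ≤ S := fun i j =>
    le_half_sum_adj H hH (F := fun i j => aNorm a (x i - x j)) (fun i => by simp [aNorm_zero ha])
      (fun i j => aNorm_nonneg _) (fun i j => aNorm_sub_comm _ _)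
      (fun i j k => by
        have := aNorm_add_le ha (x i - x j) (x j - x k)
        rwa [sub_add_sub_cancel] at this) i j
  have h1 : ∑ i, inner ℝ (W i - (1 / (Fintype.card R : ℝ)) • ∑ j, W j) (x i - xs)
      = 1 / (Fintype.card R : ℝ) * ∑ i, ∑ j, inner ℝ (W i) (x i - x j) := by
    have h5 : ∀ i, ∑ j, inner ℝ (W i) (x i - x j)
        = Fintype.card R * inner ℝ (W i) (x i) - inner ℝ (W i) (∑ j, x j) := fun i => by
      simp only [inner_sub_right, Finset.sum_sub_distrib, inner_sum, Finset.sum_const,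
        Finset.card_univ, nsmul_eq_mul]
    have h6 : ∀ i, inner ℝ (W i - (1 / (Fintype.card R : ℝ)) • ∑ j, W j) (x i - xs)
        = inner ℝ (W i) (x i) - inner ℝ (W i) xs
          - 1 / (Fintype.card R : ℝ) * (inner ℝ (∑ j, W j) (x i) - inner ℝ (∑ j, W j) xs) :=
      fun i => by
        simp only [inner_sub_left, inner_sub_right, inner_smul_left, conj_trivial]
        ring
    simp only [h5, h6, Finset.sum_sub_distrib, ← Finset.mul_sum, Finset.sum_const,
      Finset.card_univ, nsmul_eq_mul]
    simp only [← sum_inner, ← inner_sum]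
    field_simp
    ring
  have h2 : ∀ i, -(((Fintype.card R : ℝ) - 1) * (M * (n : ℝ) ^ (1 - 1 / a) * S))
      ≤ ∑ j, inner ℝ (W i) (x i - x j) := by
    intro i
    -- The term j = i vanishes. The resulting factor |R| - 1 is what makes |R|/(|R|-1) the right
    -- threshold later.
    rw [← Finset.sum_erase (Finset.univ) (a := i) (by simp)]
    have hcard : (((Finset.univ : Finset R).erase i).card : ℝ) = (Fintype.card R : ℝ) - 1 := by
      rw [Finset.card_erase_of_mem (Finset.mem_univ i), Finset.card_univ,
        Nat.cast_sub Fintype.card_pos, Nat.cast_one]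
    rw [← hcard, ← mul_neg, ← nsmul_eq_mul]
    refine Finset.card_nsmul_le_sum _ _ _ fun j _ => ?_
    refine (neg_le_neg ?_).trans (neg_abs_le _)
    refine (abs_inner_le_sum (hW i)).trans ?_
    rw [mul_assoc]
    refine mul_le_mul_of_nonneg_left ((sum_abs_le_aNorm ha _).trans ?_) hM
    exact mul_le_mul_of_nonneg_left (hS i j) (by positivity)
  rw [h1]
  have h3 := Finset.card_nsmul_le_sum Finset.univ _ _ fun i _ => h2 i
  rw [Finset.card_univ, nsmul_eq_mul] at h3
  have h4 := mul_le_mul_of_nonneg_left h3 (by positivity : 0 ≤ 1 / (Fintype.card R : ℝ))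
  rw [← mul_assoc, one_div_mul_cancel hR.ne', one_mul] at h4
  exact h4

/-- If the maximum is √n/N, the sum is 1/N + 1/r ≤ 1. If it is 1, the sum is 1/√n + 1/r: since N ≤
n, the hypothesis excludes n = 1 and forces r ≥ 3 when n = 2, so the sum is at most 1.09. -/
theorem dual_ratio_sq_le {r : ℕ} (hr : 2 ≤ r) (hn : 1 ≤ n) (ha : 1 ≤ a)
    (hN : (r : ℝ) / (r - 1) < (n : ℝ) ^ (1 - 1 / a)) :
    (max 1 (√n / (n : ℝ) ^ (1 - 1 / a)) / √n + 1 / r) ^ 2 ≤ 5 / 4 := by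
  set N := (n : ℝ) ^ (1 - 1 / a)
  have hn0 : (0 : ℝ) < n := by exact_mod_cast hn
  have hr2 : (2 : ℝ) ≤ r := by exact_mod_cast hr
  have hsq : 0 < √(n : ℝ) := Real.sqrt_pos.2 hn0
  have hN1 : 1 ≤ N := one_le_card_rpow ha hn
  have hNn : N ≤ n := card_rpow_le ha hn
  have h1 : 1 / N + 1 / r ≤ 1 := by
    have : 1 / N ≤ ((r : ℝ) - 1) / r := by
      have := one_div_le_one_div_of_le (div_pos (by linarith) (by linarith)) hN.le
      rwa [one_div_div] at this
    rw [sub_div, div_self (by positivity)] at this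
    linarith
  have h2 : 1 / √(n : ℝ) + 1 / r ≤ 109 / 100 := by
    have hlt : (r : ℝ) < n * (r - 1) := by
      have := hN.trans_le hNn
      rwa [div_lt_iff₀ (by linarith)] at this
    by_cases hn3 : 3 ≤ n
    · have : (1.73 : ℝ) ≤ √n := by
        refine Real.le_sqrt_of_sq_le ?_
        have : (3 : ℝ) ≤ n := by exact_mod_cast hn3
        norm_num; linarith
      have h3 : 1 / √(n : ℝ) ≤ 1 / 1.73 := one_div_le_one_div_of_le (by norm_num) this
      have h4 : 1 / (r : ℝ) ≤ 1 / 2 := one_div_le_one_div_of_le (by norm_num) hr2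
      norm_num at h3 h4 ⊢; linarith
    · have hn2 : n ≤ 2 := by omega
      have hn2' : (n : ℝ) ≤ 2 := by exact_mod_cast hn2
      have hne : n ≠ 1 := by
        rintro rfl
        norm_num at hlt; linarith
      have hn2'' : n = 2 := by omega
      subst hn2''
      have hr3 : 3 ≤ r := by
        have : (2 : ℝ) < r := by push_cast at hlt; linarith
        exact_mod_cast this
      have hr3' : (3 : ℝ) ≤ r := by exact_mod_cast hr3
      have : (1.4 : ℝ) ≤ √(2 : ℕ) := by
        refine Real.le_sqrt_of_sq_le ?_
        norm_num
      have h3 : 1 / √((2 : ℕ) : ℝ) ≤ 1 / 1.4 := one_div_le_one_div_of_le (by norm_num) this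
      have h4 : 1 / (r : ℝ) ≤ 1 / 3 := one_div_le_one_div_of_le (by norm_num) hr3'
      norm_num at h3 h4 ⊢; linarith
  have h3 : max 1 (√n / N) / √n + 1 / r ≤ 109 / 100 := by
    rw [← max_div_div_right hsq.le, ← max_add_add_right]
    refine max_le h2 ?_
    rw [div_div, mul_comm, ← div_div, div_self hsq.ne']
    linarith
  have h0 : 0 ≤ max 1 (√n / N) / √n + 1 / r := by positivity
  nlinarith

open Classical in
/-- The total force that the optimality gap, the penalty and the attack exert on the iterates. -/
theorem neg_two_mul_sum_inner_force_le (H : SimpleGraph R) (hH : H.Connected)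
    (hR : 2 ≤ Fintype.card R) (ha : 1 ≤ a) (hn : 1 ≤ n)
    {M φ β γ : ℝ} (hM : 0 ≤ M) (hφ : 0 < φ) (hMφ : M * Fintype.card R ≤ φ) (hβ : 1 ≤ β)
    (hγ : 0 < γ)
    {W : R → EuclideanSpace ℝ (Fin n)} (hW : ∀ i c, |W i c| ≤ M)
    {x : R → EuclideanSpace ℝ (Fin n)} {d : R → R → EuclideanSpace ℝ (Fin n)}
    (hd : ∀ i j, H.Adj i j →
      d i j ∈ subdifferential (fun y => aNorm a (y - x j)) (x i) ∧ d j i = -d i j)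
    {b : R → EuclideanSpace ℝ (Fin n)}
    (hb : ∀ i, ‖b i‖ ≤ β * max 1 (√n / (n : ℝ) ^ (1 - 1 / a)))
    (xs : EuclideanSpace ℝ (Fin n)) :
    -2 * ∑ i, inner ℝ ((W i - (1 / (Fintype.card R : ℝ)) • ∑ j, W j)
        + φ • (∑ j with H.Adj i j, d i j) + φ • b i) (x i - xs)
      ≤ 5 / 4 * γ * ∑ i, ‖x i - xs‖ ^ 2 + n * φ ^ 2 * β ^ 2 * Fintype.card R / γ := by
  have hR' : (2 : ℝ) ≤ Fintype.card R := by exact_mod_cast hR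
  have hn0 : (0 : ℝ) < n := by exact_mod_cast hn
  have hN1 : 1 ≤ (n : ℝ) ^ (1 - 1 / a) := one_le_card_rpow ha hn
  have hpen := penalty_le_sum_inner H ha hd xs
  have hhet := sum_inner_sub_mean_ge H hH ha hM hW x xs
  have hvar := sum_norm_sub_mean_sq_le W
  set w : R → EuclideanSpace ℝ (Fin n) :=
    fun i => W i - (1 / (Fintype.card R : ℝ)) • ∑ j, W j with hw
  set p : R → EuclideanSpace ℝ (Fin n) := fun i => ∑ j with H.Adj i j, d i j with hp
  set S := (∑ i, ∑ j with H.Adj i j, aNorm a (x i - x j)) / 2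
  set N := (n : ℝ) ^ (1 - 1 / a)
  set r : ℝ := (Fintype.card R : ℝ) with hr
  set K := max 1 (√n / N)
  have hS0 : 0 ≤ S := div_nonneg (Finset.sum_nonneg fun i _ => Finset.sum_nonneg fun j _ =>
    aNorm_nonneg _) two_pos.le
  have hK0 : 0 < K := by positivity
  have hsq : 0 < √(n : ℝ) := Real.sqrt_pos.2 hn0
  have hMr : M ≤ φ / r := by rwa [le_div_iff₀ (by linarith)]
  have hc : 0 < 5 / 4 * γ := by positivity
  -- reduction to a bound on the force that is not compensated by the penalty
  have hred : ∀ F : R → EuclideanSpace ℝ (Fin n),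
      ∑ i, inner ℝ (F i) (x i - xs)
        ≤ ∑ i, inner ℝ (w i + φ • p i + φ • b i) (x i - xs) →
      ∑ i, ‖F i‖ ^ 2 ≤ 5 / 4 * (n * φ ^ 2 * β ^ 2 * r) →
      -2 * ∑ i, inner ℝ (w i + φ • p i + φ • b i) (x i - xs)
      ≤ 5 / 4 * γ * ∑ i, ‖x i - xs‖ ^ 2 + n * φ ^ 2 * β ^ 2 * r / γ := by
    intro F h1 h2
    -- The Young weight 5γ/4 cancels the 5/4 in the force bound, so the noise term carries the exact
    -- constant of the final radius.
    have h3 := neg_two_mul_sum_inner_le F (fun i => x i - xs) hc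
    have h4 := mul_le_mul_of_nonneg_left h2 (by positivity : 0 ≤ 1 / (5 / 4 * γ))
    have h5 : 1 / (5 / 4 * γ) * (5 / 4 * (n * φ ^ 2 * β ^ 2 * r)) = n * φ ^ 2 * β ^ 2 * r / γ := by
      field_simp
    linarith
  have hbsq : ∀ i, ‖φ • b i‖ ^ 2 ≤ φ ^ 2 * β ^ 2 * K ^ 2 := fun i => by
    rw [norm_smul, mul_pow, Real.norm_eq_abs, sq_abs,
      show φ ^ 2 * β ^ 2 * K ^ 2 = φ ^ 2 * (β * K) ^ 2 by ring]
    exact mul_le_mul_of_nonneg_left (pow_le_pow_left₀ (norm_nonneg _) (hb i) 2) (sq_nonneg _)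
  have hexp : ∀ F : R → EuclideanSpace ℝ (Fin n), ∑ i, inner ℝ (φ • F i) (x i - xs)
      = φ * ∑ i, inner ℝ (F i) (x i - xs) := fun F => by
    simp [inner_smul_left, Finset.mul_sum]
  have hφS : 0 ≤ φ * S := by positivity
  have hpen' := mul_le_mul_of_nonneg_left hpen hφ.le
  -- Here (r - 1) M N ≤ φ, so the penalty absorbs the heterogeneity and only the attack remains. In
  -- the other case the penalty is discarded as nonnegative, and the smaller K compensates.
  by_cases hN : N ≤ r / (r - 1)
  · refine hred (fun i => φ • b i) ?_ ?_
    · simp only [inner_add_left, Finset.sum_add_distrib]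
      have h1 : (r - 1) * (M * N * S) ≤ φ * S := by
        have h2 : M * N ≤ φ / r * (r / (r - 1)) :=
          mul_le_mul hMr hN (by positivity) (by positivity)
        have h3 : φ / r * (r / (r - 1)) * (r - 1) = φ := by
          have : r - 1 ≠ 0 := by linarith
          field_simp
        have h4 : M * N * (r - 1) ≤ φ :=
          (mul_le_mul_of_nonneg_right h2 (by linarith)).trans_eq h3
        nlinarith
      have h5 := hexp p
      linarith
    · have hKn : K ^ 2 ≤ n := by
        have : K ≤ √n := max_le (Real.one_le_sqrt.2 (by exact_mod_cast hn))
          (div_le_self hsq.le hN1)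
        calc K ^ 2 ≤ √n ^ 2 := pow_le_pow_left₀ hK0.le this 2
          _ = n := Real.sq_sqrt hn0.le
      calc ∑ i, ‖φ • b i‖ ^ 2 ≤ ∑ _i : R, φ ^ 2 * β ^ 2 * n := Finset.sum_le_sum fun i _ =>
            (hbsq i).trans (mul_le_mul_of_nonneg_left hKn (by positivity))
        _ = n * φ ^ 2 * β ^ 2 * r := by
            rw [Finset.sum_const, Finset.card_univ, nsmul_eq_mul]; ring
        _ ≤ 5 / 4 * (n * φ ^ 2 * β ^ 2 * r) := by
            have : 0 ≤ n * φ ^ 2 * β ^ 2 * r := by positivity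
            linarith
  · refine hred (fun i => w i + φ • b i) ?_ ?_
    · simp only [inner_add_left, Finset.sum_add_distrib]
      have h5 := hexp p
      linarith
    · have hratio := dual_ratio_sq_le hR hn ha (not_le.1 hN)
      -- This weight is the ratio of the bounds √n φ/r on w and φ K on φ b at β = 1; it makes the
      -- sum below a perfect square. For larger β the heterogeneity term is multiplied by β² ≥ 1.
      have hs : 0 < √n / (r * K) := by positivity
      have hwsq : ∑ i, ‖w i‖ ^ 2 ≤ r * (n * (φ / r) ^ 2) := by
        refine hvar.trans ?_
        calc ∑ i, ‖W i‖ ^ 2 ≤ ∑ _i : R, n * (φ / r) ^ 2 := Finset.sum_le_sum fun i _ =>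
              norm_sq_le_of_abs_le fun c => (hW i c).trans hMr
          _ = _ := by rw [Finset.sum_const, Finset.card_univ, nsmul_eq_mul]
      have hn_sq : (n : ℝ) = √n ^ 2 := (Real.sq_sqrt hn0.le).symm
      calc ∑ i, ‖w i + φ • b i‖ ^ 2
          ≤ ∑ i, ((1 + 1 / (√n / (r * K))) * ‖w i‖ ^ 2
            + (1 + √n / (r * K)) * (φ ^ 2 * β ^ 2 * K ^ 2)) := by
            refine Finset.sum_le_sum fun i _ => ?_
            rw [add_comm (w i)]
            have h6 := norm_add_sq_le_weighted (φ • b i) (w i) hs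
            have h7 := mul_le_mul_of_nonneg_left (hbsq i)
              (by positivity : 0 ≤ 1 + √n / (r * K))
            linarith
        _ = (1 + 1 / (√n / (r * K))) * ∑ i, ‖w i‖ ^ 2
            + r * ((1 + √n / (r * K)) * (φ ^ 2 * β ^ 2 * K ^ 2)) := by
            rw [Finset.sum_add_distrib, ← Finset.mul_sum, Finset.sum_const, Finset.card_univ,
              nsmul_eq_mul]
        _ ≤ (1 + 1 / (√n / (r * K))) * (r * (n * (φ / r) ^ 2)) * β ^ 2
            + r * ((1 + √n / (r * K)) * (φ ^ 2 * β ^ 2 * K ^ 2)) := by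
            have h8 := mul_le_mul_of_nonneg_left hwsq
              (by positivity : 0 ≤ 1 + 1 / (√n / (r * K)))
            have h9 : (1 + 1 / (√n / (r * K))) * (r * (n * (φ / r) ^ 2)) * 1
                ≤ (1 + 1 / (√n / (r * K))) * (r * (n * (φ / r) ^ 2)) * β ^ 2 :=
              mul_le_mul_of_nonneg_left (one_le_pow₀ hβ) (by positivity)
            linarith
        _ = (K / √n + 1 / r) ^ 2 * (n * φ ^ 2 * β ^ 2 * r) := by
            rw [hn_sq, Real.sqrt_sq hsq.le]
            have : r ≠ 0 := by positivity
            field_simp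
            ring
        _ ≤ 5 / 4 * (n * φ ^ 2 * β ^ 2 * r) :=
            mul_le_mul_of_nonneg_right hratio (by positivity)

end Forces

/-! ### One iteration along a path -/

section OneStep

theorem abs_le_maxNorm {n : ℕ} (v : EuclideanSpace ℝ (Fin n)) (c : Fin n) : |v c| ≤ maxNorm v :=
  le_ciSup (f := fun e => |v e|) (Set.finite_range _).bddAbove c

theorem edgeSet_nonempty_of_connected {R : Type*} [Fintype R] {H : SimpleGraph R}
    (hH : H.Connected) (hR : 2 ≤ Fintype.card R) : H.edgeSet.Nonempty := by
  obtain ⟨u, v, huv⟩ := Fintype.exists_pair_of_one_lt_card (α := R) (by omega)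
  obtain ⟨p⟩ := hH.preconnected u v
  cases p with
  | nil => exact absurd rfl huv
  | @cons _ w _ h _ => exact ⟨s(u, w), h⟩

variable {R B : Type*} [Fintype R] [LinearOrder R] {n : ℕ}
  {pb : CompositeProblem R n} {μi : R → ℝ} {Lil : (i : R) → Fin (pb.q i) → ℝ}
  {Gr : SimpleGraph (R ⊕ B)}

/-- Since λ_min(Π) ≤ √|R| and |E_R| ≥ 1, the threshold is at least |R| times the largest max-norm.
-/
theorem maxNorm_mul_card_le_of_phiMin_le (hR : 2 ≤ Fintype.card R)
    (hGr : (reliableGraph Gr).Connected) {xs g' : EuclideanSpace ℝ (Fin n)} {φ : ℝ}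
    (hφ : phiMin pb Gr xs g' ≤ φ) :
    (⨆ i, maxNorm (gradient (pb.localObj i) xs + g')) * Fintype.card R ≤ φ := by
  classical
  have hE := edgeSet_nonempty_of_connected hGr hR
  have hr0 : (0 : ℝ) < Fintype.card R := by exact_mod_cast (by omega : 0 < Fintype.card R)
  have hM : 0 ≤ ⨆ i, maxNorm (gradient (pb.localObj i) xs + g') :=
    Real.iSup_nonneg fun i => Real.iSup_nonneg fun c => abs_nonneg _
  have hE1 : 1 ≤ √((reliableGraph Gr).edgeSet.ncard : ℝ) := by
    rw [Real.one_le_sqrt]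
    exact_mod_cast (Set.ncard_pos (Set.toFinite _)).2 hE
  unfold phiMin at hφ
  obtain ⟨hpos, hle⟩ := minSingularValue_incidence (reliableGraph Gr) hE
  set M := ⨆ i, maxNorm (gradient (pb.localObj i) xs + g')
  rw [div_le_iff₀ (by convert! hpos)] at hφ
  have hpow : (Fintype.card R : ℝ) ^ (3 / 2 : ℝ) = Fintype.card R * √(Fintype.card R) := by
    rw [Real.sqrt_eq_rpow, show (3 / 2 : ℝ) = 1 + 1 / 2 by norm_num, Real.rpow_add hr0,
      Real.rpow_one]
  have hφ0 : 0 ≤ φ := by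
    refine nonneg_of_mul_nonneg_left (le_trans (by positivity) hφ) (by convert! hpos)
  have h1 := hφ.trans (mul_le_mul_of_nonneg_left (by convert! hle) hφ0)
  rw [hpow] at h1
  have hs : 0 < √(Fintype.card R : ℝ) := Real.sqrt_pos.2 hr0
  have h2 : Fintype.card R * M ≤ Fintype.card R * M * √((reliableGraph Gr).edgeSet.ncard : ℝ) :=
    le_mul_of_one_le_right (by positivity) hE1
  have h3 : (Fintype.card R * M * √((reliableGraph Gr).edgeSet.ncard : ℝ)) * √(Fintype.card R : ℝ)
      ≤ φ * √(Fintype.card R : ℝ) := by linarith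
  have h4 := le_of_mul_le_mul_right h3 hs
  linarith

variable [Fintype B]

theorem IsProxDBROPath.sqDist_succ_le (hpb : pb.ConvexSmooth μi Lil) (hn : 1 ≤ n)
    {xs : EuclideanSpace ℝ (Fin n)} (hxs : pb.IsOptimal xs) (hR : 2 ≤ Fintype.card R)
    (hGr : (reliableGraph Gr).Connected) (hB : 1 ≤ Fintype.card B) {a : ℝ} (ha : 1 ≤ a)
    {g' : EuclideanSpace ℝ (Fin n)} {φ : ℝ} (hφ : 0 < φ) (hφmin : phiMin pb Gr xs g' ≤ φ)
    {γ : ℝ} (hγ : 0 < γ) {α : ℕ → ℝ} {r : ℕ → R → EuclideanSpace ℝ (Fin n)}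
    {z : ℕ → R → B → EuclideanSpace ℝ (Fin n)} {x : ℕ → R → EuclideanSpace ℝ (Fin n)}
    (hx : IsProxDBROPath pb.g Gr a φ α r z x) (k : ℕ) (hα : 0 < α k) :
    sqDist (x (k + 1)) xs ≤ sqDist (x k) xs
      - 2 * α k * ∑ i, inner ℝ (r k i - gradient (pb.localObj i) xs) (x k i - xs)
      + α k * (5 / 4 * γ * sqDist (x k) xs
        + n * φ ^ 2 * (Fintype.card B : ℝ) ^ 2 * Fintype.card R / γ)
      + α k ^ 2 * (2 * ∑ i, ‖r k i - gradient (pb.localObj i) xs‖ ^ 2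
        + 16 * n * φ ^ 2 * (Fintype.card R : ℝ) ^ 3
        + 4 * n * φ ^ 2 * (Fintype.card B : ℝ) ^ 2 * Fintype.card R) := by
  classical
  have : Nonempty R := hGr.nonempty
  obtain ⟨d, e, hd, he, hprox⟩ := hx k
  set v : R → EuclideanSpace ℝ (Fin n) := fun i => gradient (pb.localObj i) xs with hv
  set W : R → EuclideanSpace ℝ (Fin n) := fun i => v i + g' with hWdef
  set M := ⨆ i, maxNorm (W i) with hMdef
  have hM : 0 ≤ M := Real.iSup_nonneg fun i => Real.iSup_nonneg fun c => abs_nonneg _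
  have hW : ∀ i c, |W i c| ≤ M := fun i c =>
    (abs_le_maxNorm (W i) c).trans
      (le_ciSup (f := fun i => maxNorm (W i)) (Set.finite_range _).bddAbove i)
  have hMφ : M * Fintype.card R ≤ φ := maxNorm_mul_card_le_of_phiMin_le hR hGr hφmin
  set β : ℝ := (Fintype.card B : ℝ) with hβdef
  have hβ : 1 ≤ β := by rw [hβdef]; exact_mod_cast hB
  set ρ : ℝ := (Fintype.card R : ℝ) with hρ
  have hρ2 : 2 ≤ ρ := by rw [hρ]; exact_mod_cast hR
  have hn0 : (0 : ℝ) < n := by exact_mod_cast hn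
  set g0 : EuclideanSpace ℝ (Fin n) := -((1 / ρ) • ∑ i, v i) with hg0def
  have hg0 : g0 ∈ subdifferential pb.g xs := hpb.neg_mean_gradient_mem hxs
  set p : R → EuclideanSpace ℝ (Fin n) := fun i => ∑ j with (reliableGraph Gr).Adj i j, d i j
    with hp
  set b : R → EuclideanSpace ℝ (Fin n) := fun i => ∑ c with Gr.Adj (Sum.inl i) (Sum.inr c), e i c
    with hbdef
  -- The common shift g' cancels in the deviation from the mean, so the force is governed by the W_i
  -- even though the prox comparison uses g0.
  have hw : ∀ i, W i - (1 / ρ) • ∑ j, W j = v i + g0 := fun i => by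
    have h0 : ρ ≠ 0 := by positivity
    simp only [hWdef, hg0def, Finset.sum_add_distrib, Finset.sum_const, Finset.card_univ,
      smul_add, ← Nat.cast_smul_eq_nsmul ℝ, smul_smul, ← hρ, one_div_mul_cancel h0, one_smul]
    abel
  have hb : ∀ i, ‖b i‖ ≤ β * max 1 (√n / (n : ℝ) ^ (1 - 1 / a)) := fun i => by
    refine (norm_sum_le_of_le _ fun c hc => norm_le_of_inner_le_aNorm ha hn
      (inner_le_aNorm_of_subgradient ha (he i c (Finset.mem_filter.1 hc).2))).trans ?_
    rw [Finset.sum_const, nsmul_eq_mul]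
    refine mul_le_mul_of_nonneg_right ?_ (by positivity)
    rw [hβdef]
    exact_mod_cast Finset.card_le_univ _
  have hforce := neg_two_mul_sum_inner_force_le (reliableGraph Gr) hGr hR ha hn hM hφ hMφ hβ hγ hW
    hd hb xs
  -- sizes of the forces
  have hsqrt : √(n : ℝ) ^ 2 = n := Real.sq_sqrt hn0.le
  have hbsq : ∀ i, ‖φ • b i‖ ^ 2 ≤ n * φ ^ 2 * β ^ 2 := fun i => by
    have h1 : ‖b i‖ ≤ β * √n := by
      refine (norm_sum_le_of_le _ fun c hc => norm_le_sqrt_of_inner_le_aNorm ha hn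
        (inner_le_aNorm_of_subgradient ha (he i c (Finset.mem_filter.1 hc).2))).trans ?_
      rw [Finset.sum_const, nsmul_eq_mul]
      refine mul_le_mul_of_nonneg_right ?_ (by positivity)
      rw [hβdef]
      exact_mod_cast Finset.card_le_univ _
    have h2 := pow_le_pow_left₀ (norm_nonneg _) h1 2
    rw [mul_pow, hsqrt] at h2
    rw [norm_smul, mul_pow, Real.norm_eq_abs, sq_abs]
    have h3 := mul_le_mul_of_nonneg_left h2 (sq_nonneg φ)
    linarith
  have hpsq : ∀ i, ‖φ • p i‖ ^ 2 ≤ n * φ ^ 2 * ρ ^ 2 := fun i => by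
    have h1 : ‖p i‖ ≤ ρ * √n := by
      refine (norm_sum_le_of_le _ fun j hj => norm_le_sqrt_of_inner_le_aNorm ha hn
        (inner_le_aNorm_of_subgradient ha (hd i j (Finset.mem_filter.1 hj).2).1)).trans ?_
      rw [Finset.sum_const, nsmul_eq_mul]
      refine mul_le_mul_of_nonneg_right ?_ (by positivity)
      rw [hρ]
      exact_mod_cast Finset.card_le_univ _
    have h2 := pow_le_pow_left₀ (norm_nonneg _) h1 2
    rw [mul_pow, hsqrt] at h2
    rw [norm_smul, mul_pow, Real.norm_eq_abs, sq_abs]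
    have h3 := mul_le_mul_of_nonneg_left h2 (sq_nonneg φ)
    linarith
  have hwsq : ∑ i, ‖v i + g0‖ ^ 2 ≤ n * φ ^ 2 * ρ ^ 3 := by
    have h1 := sum_norm_sub_mean_sq_le W
    simp only [← hρ, hw] at h1
    have hMφ' : M ≤ φ := by nlinarith
    calc ∑ i, ‖v i + g0‖ ^ 2 ≤ ∑ i, ‖W i‖ ^ 2 := h1
      _ ≤ ∑ _i : R, n * φ ^ 2 := Finset.sum_le_sum fun i _ =>
          norm_sq_le_of_abs_le fun c => (hW i c).trans hMφ'
      _ = ρ * (n * φ ^ 2) := by rw [Finset.sum_const, Finset.card_univ, nsmul_eq_mul]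
      _ ≤ n * φ ^ 2 * ρ ^ 3 := by
          have h2 : 0 ≤ n * φ ^ 2 := by positivity
          have h3 : ρ ≤ ρ ^ 3 := le_self_pow₀ (by linarith) (by norm_num)
          nlinarith
  have hCsq : ∑ i, ‖v i + g0 + φ • p i‖ ^ 2 ≤ 4 * (n * φ ^ 2 * ρ ^ 3) := by
    calc ∑ i, ‖v i + g0 + φ • p i‖ ^ 2
        ≤ ∑ i, (2 * ‖v i + g0‖ ^ 2 + 2 * (n * φ ^ 2 * ρ ^ 2)) := Finset.sum_le_sum fun i _ => by
          have h1 := norm_add_sq_le_weighted (v i + g0) (φ • p i) one_pos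
          have h2 := hpsq i
          norm_num at h1
          linarith
      _ = 2 * ∑ i, ‖v i + g0‖ ^ 2 + ρ * (2 * (n * φ ^ 2 * ρ ^ 2)) := by
          rw [Finset.sum_add_distrib, Finset.mul_sum, Finset.sum_const, Finset.card_univ,
            nsmul_eq_mul]
      _ ≤ _ := by nlinarith
  have hDsq : ∑ i, ‖φ • b i‖ ^ 2 ≤ ρ * (n * φ ^ 2 * β ^ 2) := by
    calc ∑ i, ‖φ • b i‖ ^ 2 ≤ ∑ _i : R, n * φ ^ 2 * β ^ 2 := Finset.sum_le_sum fun i _ => hbsq i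
      _ = _ := by rw [Finset.sum_const, Finset.card_univ, nsmul_eq_mul]
  -- the proximal step is nonexpansive
  have hstep : ∀ i, ‖x (k + 1) i - xs‖ ^ 2 ≤ ‖x k i - xs‖ ^ 2
      - 2 * α k * inner ℝ (r k i - v i) (x k i - xs)
      - 2 * α k * inner ℝ (v i + g0 + φ • p i + φ • b i) (x k i - xs)
      + α k ^ 2 * (2 * ‖r k i - v i‖ ^ 2 + 4 * ‖v i + g0 + φ • p i‖ ^ 2 + 4 * ‖φ • b i‖ ^ 2) := by
    intro i
    have h1 := pow_le_pow_left₀ (norm_nonneg _) ((hprox i).norm_sub_le hα hpb.convex_g hg0) 2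
    have h2 : x k i - α k • r k i - (α k * φ) • (p i + b i) - xs - α k • g0
        = (x k i - xs) - α k • ((r k i - v i) + (v i + g0 + φ • p i) + φ • b i) := by
      module
    have h3 := norm_add_add_sq_le (r k i - v i) (v i + g0 + φ • p i) (φ • b i)
    refine h1.trans ?_
    rw [h2, norm_sub_sq_real, inner_smul_right, norm_smul, mul_pow, Real.norm_eq_abs, sq_abs,
      real_inner_comm, add_assoc (r k i - v i), inner_add_left]
    rw [add_assoc (r k i - v i)] at h3
    have h4 := mul_le_mul_of_nonneg_left h3 (sq_nonneg (α k))
    linarith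
  have hsum := Finset.sum_le_sum fun i (_ : i ∈ Finset.univ) => hstep i
  simp only [Finset.sum_add_distrib, Finset.sum_sub_distrib, ← Finset.mul_sum] at hsum
  simp only [← hρ, hw] at hforce
  have h5 := mul_le_mul_of_nonneg_left hforce hα.le
  have h6 : α k ^ 2 * (2 * ∑ i, ‖r k i - v i‖ ^ 2 + 4 * ∑ i, ‖v i + g0 + φ • p i‖ ^ 2
      + 4 * ∑ i, ‖φ • b i‖ ^ 2) ≤ α k ^ 2 * (2 * ∑ i, ‖r k i - v i‖ ^ 2
        + 16 * n * φ ^ 2 * ρ ^ 3 + 4 * n * φ ^ 2 * β ^ 2 * ρ) :=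
    mul_le_mul_of_nonneg_left (by linarith) (sq_nonneg _)
  unfold sqDist
  linarith

end OneStep

/-! ### Variance-reduced estimators -/

section Estimator

variable {R Ω : Type*} {n : ℕ}

theorem measurable_norm_sub_sq {m : MeasurableSpace Ω} {f : Ω → EuclideanSpace ℝ (Fin n)}
    (hf : Measurable f) (c : EuclideanSpace ℝ (Fin n)) : Measurable fun ω => ‖f ω - c‖ ^ 2 :=
  ((hf.sub_const c).norm).pow_const 2

theorem measurable_inner_sub {m : MeasurableSpace Ω} {f g : Ω → EuclideanSpace ℝ (Fin n)}
    (hf : Measurable f) (hg : Measurable g) (b c : EuclideanSpace ℝ (Fin n)) :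
    Measurable fun ω => (inner ℝ (f ω - b) (g ω - c) : ℝ) :=
  (hf.sub_const b).inner (hg.sub_const c)

theorem integral_indicator_preimage_of_indep {S : Type*} [MeasurableSpace S]
    {m mΩ : MeasurableSpace Ω} {P : Measure Ω} (hm : m ≤ mΩ) {Y : Ω → S} (hY : Measurable Y)
    {t : Set S} (ht : MeasurableSet t)
    (hind : Indep (MeasurableSpace.comap Y inferInstance) m P) {h : Ω → ℝ} (hh : Measurable[m] h) :
    ∫ ω, (Y ⁻¹' t).indicator h ω ∂P = P.real (Y ⁻¹' t) * ∫ ω, h ω ∂P := by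
  have hindep : IndepFun Y h P := by
    rw [IndepFun_iff_Indep]
    exact indep_of_indep_of_le_right hind hh.comap_le
  have h1 := hindep.integral_fun_comp_mul_comp (f := t.indicator fun _ => (1 : ℝ)) (g := id)
    hY.aemeasurable (hh.mono hm le_rfl).aemeasurable
    (measurable_const.indicator ht).aestronglyMeasurable measurable_id.aestronglyMeasurable
  have h2 : ∀ ω, t.indicator (fun _ => (1 : ℝ)) (Y ω) = (Y ⁻¹' t).indicator (fun _ => (1 : ℝ)) ω :=
    fun ω => rfl
  have h3 : ∫ ω, (Y ⁻¹' t).indicator (fun _ => (1 : ℝ)) ω ∂P = P.real (Y ⁻¹' t) := by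
    rw [integral_indicator_const _ (hY ht), smul_eq_mul, mul_one]
  simp only [h2, h3, id] at h1
  rw [← h1]
  refine integral_congr_ae (Eventually.of_forall fun ω => ?_)
  by_cases hω : ω ∈ Y ⁻¹' t <;> simp [hω]

/-- The law of a quantity evaluated at a uniform draw that is independent of the history. -/
theorem integral_uniform_draw {m mΩ : MeasurableSpace Ω} {P : Measure Ω} (hm : m ≤ mΩ) {q : ℕ}
    {s : Ω → Fin q} (hs : Measurable s) (hind : Indep (MeasurableSpace.comap s ⊤) m P)
    (hunif : ∀ l, P.real {ω | s ω = l} = 1 / (q : ℝ)) {h : Fin q → Ω → ℝ}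
    (hmeas : ∀ l, Measurable[m] (h l)) (hint : ∀ l, Integrable (h l) P) :
    Integrable (fun ω => h (s ω) ω) P ∧
      ∫ ω, h (s ω) ω ∂P = 1 / (q : ℝ) * ∫ ω, ∑ l, h l ω ∂P := by
  have hset : ∀ l, MeasurableSet (s ⁻¹' {l}) := fun l => hs (measurableSet_singleton l)
  have h1 : (fun ω => h (s ω) ω) = fun ω => ∑ l, (s ⁻¹' {l}).indicator (h l) ω := by
    funext ω
    rw [Finset.sum_eq_single (s ω), Set.indicator_of_mem (show ω ∈ s ⁻¹' {s ω} from rfl)]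
    · exact fun l _ hl => Set.indicator_of_notMem
        (show ω ∉ s ⁻¹' {l} from fun h => hl (Eq.symm h)) _
    · simp
  have hint' : ∀ l, Integrable ((s ⁻¹' {l}).indicator (h l)) P := fun l =>
    (hint l).indicator (hset l)
  refine ⟨by rw [h1]; exact integrable_finsetSum _ fun l _ => hint' l, ?_⟩
  rw [h1, integral_finsetSum _ fun l _ => hint' l, integral_finsetSum _ fun l _ => hint l,
    Finset.mul_sum]
  refine Finset.sum_congr rfl fun l _ => ?_
  rw [integral_indicator_preimage_of_indep hm hs (measurableSet_singleton l) hind (hmeas l),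
    ← hunif l]
  rfl

namespace CompositeProblem

variable (pb : CompositeProblem R n)

/-- The variance-reduced estimate of `∇ f_i y` with drawn sample `l` and stored points `u`. -/
noncomputable def vrEstimate (i : R) (l : Fin (pb.q i)) (y : EuclideanSpace ℝ (Fin n))
    (u : Fin (pb.q i) → EuclideanSpace ℝ (Fin n)) : EuclideanSpace ℝ (Fin n) :=
  gradient (pb.f i l) y - gradient (pb.f i l) (u l)
    + (1 / (pb.q i : ℝ)) • ∑ j, gradient (pb.f i j) (u j)

end CompositeProblem

variable {pb : CompositeProblem R n} {μi : R → ℝ} {Lil : (i : R) → Fin (pb.q i) → ℝ}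

namespace CompositeProblem.ConvexSmooth

theorem mean_vrEstimate (h : pb.ConvexSmooth μi Lil) (i : R) (y : EuclideanSpace ℝ (Fin n))
    (u : Fin (pb.q i) → EuclideanSpace ℝ (Fin n)) :
    (1 / (pb.q i : ℝ)) • ∑ l, pb.vrEstimate i l y u = gradient (pb.localObj i) y := by
  have hq : (pb.q i : ℝ) ≠ 0 := by have := pb.q_pos i; positivity
  rw [h.gradient_localObj]
  congr 1
  simp only [CompositeProblem.vrEstimate, Finset.sum_add_distrib, Finset.sum_sub_distrib,
    Finset.sum_const, Finset.card_univ, Fintype.card_fin, ← Nat.cast_smul_eq_nsmul ℝ, smul_smul,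
    mul_one_div_cancel hq, one_smul]
  abel

theorem measurable_vrEstimate (h : pb.ConvexSmooth μi Lil) {m : MeasurableSpace Ω} (i : R)
    (l : Fin (pb.q i)) {y : Ω → EuclideanSpace ℝ (Fin n)} (hy : Measurable y)
    {u : Ω → Fin (pb.q i) → EuclideanSpace ℝ (Fin n)} (hu : ∀ j, Measurable fun ω => u ω j) :
    Measurable fun ω => pb.vrEstimate i l (y ω) (u ω) := by
  have h1 : ∀ j, Measurable (gradient (pb.f i j)) := fun j => (h.continuous_gradient i j).measurable
  have h2 : Measurable fun ω => ∑ j, gradient (pb.f i j) (u ω j) :=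
    Finset.measurable_fun_sum _ fun j _ => (h1 j).comp (hu j)
  exact (((h1 l).comp hy).sub ((h1 l).comp (hu l))).add (h2.const_smul (1 / (pb.q i : ℝ)))

/-- The error splits into the change of one component gradient from xs to y, and a centred variable
over the draws whose variance is at most its second moment. Only Lipschitz bounds on the components
enter. -/
theorem mean_norm_vrEstimate_sub_sq_le (h : pb.ConvexSmooth μi Lil) {L : ℝ}
    (hL : ∀ i l, Lil i l ≤ L) (i : R) (xs y : EuclideanSpace ℝ (Fin n))
    (u : Fin (pb.q i) → EuclideanSpace ℝ (Fin n)) :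
    1 / (pb.q i : ℝ) * ∑ l, ‖pb.vrEstimate i l y u - gradient (pb.localObj i) xs‖ ^ 2
      ≤ 2 * L ^ 2 * ‖y - xs‖ ^ 2 + 2 * L ^ 2 * (1 / (pb.q i : ℝ) * ∑ l, ‖u l - xs‖ ^ 2) := by
  have hq : (0 : ℝ) < pb.q i := by exact_mod_cast pb.q_pos i
  have hlip : ∀ l z, ‖gradient (pb.f i l) z - gradient (pb.f i l) xs‖ ^ 2 ≤ L ^ 2 * ‖z - xs‖ ^ 2 :=
    fun l z => by
      rw [← mul_pow]
      exact pow_le_pow_left₀ (norm_nonneg _) ((h.smooth i l z xs).trans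
        (mul_le_mul_of_nonneg_right (hL i l) (norm_nonneg _))) 2
  set C : Fin (pb.q i) → EuclideanSpace ℝ (Fin n) :=
    fun l => gradient (pb.f i l) (u l) - gradient (pb.f i l) xs with hC
  have hvar := sum_norm_sub_mean_sq_le C
  rw [Fintype.card_fin] at hvar
  have hterm : ∀ l, ‖pb.vrEstimate i l y u - gradient (pb.localObj i) xs‖ ^ 2
      ≤ 2 * (L ^ 2 * ‖y - xs‖ ^ 2) + 2 * ‖C l - (1 / (pb.q i : ℝ)) • ∑ j, C j‖ ^ 2 := by
    intro l
    have h1 : pb.vrEstimate i l y u - gradient (pb.localObj i) xs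
        = (gradient (pb.f i l) y - gradient (pb.f i l) xs)
          + -(C l - (1 / (pb.q i : ℝ)) • ∑ j, C j) := by
      simp only [h.gradient_localObj, CompositeProblem.vrEstimate, hC, Finset.sum_sub_distrib,
        smul_sub]
      abel
    have h2 := norm_add_sq_le_weighted (gradient (pb.f i l) y - gradient (pb.f i l) xs)
      (-(C l - (1 / (pb.q i : ℝ)) • ∑ j, C j)) one_pos
    rw [norm_neg] at h2
    have h3 := hlip l y
    rw [h1]
    norm_num at h2 ⊢
    linarith
  have h4 : ∑ l, ‖C l‖ ^ 2 ≤ L ^ 2 * ∑ l, ‖u l - xs‖ ^ 2 := by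
    rw [Finset.mul_sum]
    exact Finset.sum_le_sum fun l _ => hlip l (u l)
  have h5 : ∑ l, ‖pb.vrEstimate i l y u - gradient (pb.localObj i) xs‖ ^ 2
      ≤ pb.q i * (2 * L ^ 2 * ‖y - xs‖ ^ 2) + 2 * L ^ 2 * ∑ l, ‖u l - xs‖ ^ 2 := by
    refine (Finset.sum_le_sum fun l _ => hterm l).trans ?_
    simp only [Finset.sum_add_distrib, ← Finset.mul_sum, Finset.sum_const, Finset.card_univ,
      Fintype.card_fin, nsmul_eq_mul]
    linarith
  refine (mul_le_mul_of_nonneg_left h5 (by positivity : 0 ≤ 1 / (pb.q i : ℝ))).trans_eq ?_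
  field_simp

end CompositeProblem.ConvexSmooth

/-- Random iterates `x` with variance-reduced gradient estimates: `s` are the uniform draws, `u` the
stored points, and `π i` is the probability that a stored point of agent `i` is refreshed. -/
structure IsVarianceReduced (pb : CompositeProblem R n) {mΩ : MeasurableSpace Ω} (P : Measure Ω)
    (ℱ : Filtration ℕ mΩ) (π : R → ℝ) (x : ℕ → Ω → R → EuclideanSpace ℝ (Fin n))
    (s : ℕ → Ω → (i : R) → Fin (pb.q i))
    (u : ℕ → Ω → (i : R) → Fin (pb.q i) → EuclideanSpace ℝ (Fin n)) : Prop where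
  measurable_x : ∀ k i, Measurable[ℱ k] fun ω => x k ω i
  uniform : UniformDraws pb P ℱ s
  init : ∀ ω i l, u 0 ω i l = x 0 ω i
  refresh : ∀ k i l, ∃ A : Set Ω, MeasurableSet[ℱ (k + 1)] A ∧
    (∀ h : Ω → ℝ, Measurable[ℱ k] h → ∫ ω, A.indicator h ω ∂P = π i * ∫ ω, h ω ∂P) ∧
    ∀ ω, (ω ∈ A → u (k + 1) ω i l = x k ω i) ∧ (ω ∉ A → u (k + 1) ω i l = u k ω i l)

/-- The mean squared distance of the stored points of agent `i` to `xs`. -/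
noncomputable def storedDist (pb : CompositeProblem R n) (xs : EuclideanSpace ℝ (Fin n)) (i : R)
    (u : Fin (pb.q i) → EuclideanSpace ℝ (Fin n)) : ℝ :=
  1 / (pb.q i : ℝ) * ∑ l, ‖u l - xs‖ ^ 2

namespace IsVarianceReduced

variable {mΩ : MeasurableSpace Ω} {P : Measure Ω} {ℱ : Filtration ℕ mΩ} {π : R → ℝ}
  {x : ℕ → Ω → R → EuclideanSpace ℝ (Fin n)} {s : ℕ → Ω → (i : R) → Fin (pb.q i)}
  {u : ℕ → Ω → (i : R) → Fin (pb.q i) → EuclideanSpace ℝ (Fin n)}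

theorem measurable_u (hv : IsVarianceReduced pb P ℱ π x s u) (k : ℕ) (i : R) (l : Fin (pb.q i)) :
    Measurable[ℱ k] fun ω => u k ω i l := by
  classical
  induction k with
  | zero => simpa only [hv.init] using hv.measurable_x 0 i
  | succ k ih =>
    obtain ⟨A, hA, -, hu⟩ := hv.refresh k i l
    have h1 : (fun ω => u (k + 1) ω i l) = A.piecewise (fun ω => x k ω i) fun ω => u k ω i l := by
      funext ω
      by_cases hω : ω ∈ A
      · rw [Set.piecewise_eq_of_mem _ _ _ hω, (hu ω).1 hω]
      · rw [Set.piecewise_eq_of_notMem _ _ _ hω, (hu ω).2 hω]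
    rw [h1]
    exact Measurable.piecewise hA ((hv.measurable_x k i).mono (ℱ.mono k.le_succ) le_rfl)
      (ih.mono (ℱ.mono k.le_succ) le_rfl)

theorem measurable_normSq_x (hv : IsVarianceReduced pb P ℱ π x s u)
    (xs : EuclideanSpace ℝ (Fin n)) (k : ℕ) (i : R) :
    Measurable[ℱ k] fun ω => ‖x k ω i - xs‖ ^ 2 :=
  measurable_norm_sub_sq (hv.measurable_x k i) xs

theorem measurable_normSq_u (hv : IsVarianceReduced pb P ℱ π x s u)
    (xs : EuclideanSpace ℝ (Fin n)) (k : ℕ) (i : R) (l : Fin (pb.q i)) :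
    Measurable[ℱ k] fun ω => ‖u k ω i l - xs‖ ^ 2 :=
  measurable_norm_sub_sq (hv.measurable_u k i l) xs

theorem integrable_storedDist {xs : EuclideanSpace ℝ (Fin n)} {k : ℕ} {i : R}
    (hu : ∀ l, Integrable (fun ω => ‖u k ω i l - xs‖ ^ 2) P) :
    Integrable (fun ω => storedDist pb xs i (u k ω i)) P :=
  (integrable_finsetSum _ fun l _ => hu l).const_mul _

/-- Evolution of the stored points. -/
theorem storedDist_succ (hv : IsVarianceReduced pb P ℱ π x s u) (xs : EuclideanSpace ℝ (Fin n))
    (k : ℕ) (i : R) (hx : Integrable (fun ω => ‖x k ω i - xs‖ ^ 2) P)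
    (hu : ∀ l, Integrable (fun ω => ‖u k ω i l - xs‖ ^ 2) P) :
    (∀ l, Integrable (fun ω => ‖u (k + 1) ω i l - xs‖ ^ 2) P) ∧
      ∫ ω, storedDist pb xs i (u (k + 1) ω i) ∂P
        = (1 - π i) * ∫ ω, storedDist pb xs i (u k ω i) ∂P
          + π i * ∫ ω, ‖x k ω i - xs‖ ^ 2 ∂P := by
  have hq : (pb.q i : ℝ) ≠ 0 := by have := pb.q_pos i; positivity
  have key : ∀ l, Integrable (fun ω => ‖u (k + 1) ω i l - xs‖ ^ 2) P ∧
      ∫ ω, ‖u (k + 1) ω i l - xs‖ ^ 2 ∂P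
        = (1 - π i) * ∫ ω, ‖u k ω i l - xs‖ ^ 2 ∂P + π i * ∫ ω, ‖x k ω i - xs‖ ^ 2 ∂P := by
    intro l
    obtain ⟨A, hA, hAint, hA'⟩ := hv.refresh k i l
    have hdiff : Integrable (fun ω => ‖x k ω i - xs‖ ^ 2 - ‖u k ω i l - xs‖ ^ 2) P :=
      hx.sub (hu l)
    have hmeas : Measurable[ℱ k] fun ω => ‖x k ω i - xs‖ ^ 2 - ‖u k ω i l - xs‖ ^ 2 :=
      Measurable.sub (hv.measurable_normSq_x xs k i) (hv.measurable_normSq_u xs k i l)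
    -- Writing the update as old value plus indicator times a past-measurable difference lets
    -- `refresh` evaluate the expectation.
    have h1 : (fun ω => ‖u (k + 1) ω i l - xs‖ ^ 2) = fun ω => ‖u k ω i l - xs‖ ^ 2
        + A.indicator (fun ω => ‖x k ω i - xs‖ ^ 2 - ‖u k ω i l - xs‖ ^ 2) ω := by
      funext ω
      by_cases hω : ω ∈ A
      · rw [Set.indicator_of_mem hω, (hA' ω).1 hω]; ring
      · rw [Set.indicator_of_notMem hω, (hA' ω).2 hω, add_zero]
    have hind : Integrable (A.indicator
        fun ω => ‖x k ω i - xs‖ ^ 2 - ‖u k ω i l - xs‖ ^ 2) P :=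
      hdiff.indicator (ℱ.le _ _ hA)
    refine ⟨by rw [h1]; exact (hu l).add hind, ?_⟩
    rw [h1, integral_add (hu l) hind,
      hAint _ hmeas, integral_sub hx (hu l)]
    ring
  refine ⟨fun l => (key l).1, ?_⟩
  simp only [storedDist, integral_const_mul]
  rw [integral_finsetSum _ fun l _ => (key l).1, integral_finsetSum _ fun l _ => hu l]
  simp only [(key _).2, Finset.sum_add_distrib, Finset.sum_const, Finset.card_univ,
    Fintype.card_fin, nsmul_eq_mul, ← Finset.mul_sum]
  field_simp

/-- Unbiasedness and second moment of the estimator. -/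
theorem estimate_moments (hv : IsVarianceReduced pb P ℱ π x s u)
    (h : pb.ConvexSmooth μi Lil) {L : ℝ} (hL : ∀ i l, Lil i l ≤ L)
    (xs : EuclideanSpace ℝ (Fin n)) (k : ℕ) (i : R)
    (hx : Integrable (fun ω => ‖x k ω i - xs‖ ^ 2) P)
    (hu : ∀ l, Integrable (fun ω => ‖u k ω i l - xs‖ ^ 2) P) :
    (Integrable (fun ω => inner ℝ (pb.vrEstimate i (s k ω i) (x k ω i) (u k ω i)
        - gradient (pb.localObj i) xs) (x k ω i - xs)) P ∧
      μi i * ∫ ω, ‖x k ω i - xs‖ ^ 2 ∂P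
        ≤ ∫ ω, inner ℝ (pb.vrEstimate i (s k ω i) (x k ω i) (u k ω i)
          - gradient (pb.localObj i) xs) (x k ω i - xs) ∂P) ∧
    (Integrable (fun ω => ‖pb.vrEstimate i (s k ω i) (x k ω i) (u k ω i)
        - gradient (pb.localObj i) xs‖ ^ 2) P ∧
      ∫ ω, ‖pb.vrEstimate i (s k ω i) (x k ω i) (u k ω i) - gradient (pb.localObj i) xs‖ ^ 2 ∂P
        ≤ 2 * L ^ 2 * ∫ ω, ‖x k ω i - xs‖ ^ 2 ∂P
          + 2 * L ^ 2 * ∫ ω, storedDist pb xs i (u k ω i) ∂P) := by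
  have hq : (0 : ℝ) < pb.q i := by exact_mod_cast pb.q_pos i
  obtain ⟨hs, hind, hunif⟩ := hv.uniform k i
  have hs' : Measurable fun ω => s k ω i := hs.mono (ℱ.le _) le_rfl
  have hst := integrable_storedDist hu
  set G : Fin (pb.q i) → Ω → EuclideanSpace ℝ (Fin n) := fun l ω =>
    pb.vrEstimate i l (x k ω i) (u k ω i) - gradient (pb.localObj i) xs with hG
  have hGmeas : ∀ l, Measurable[ℱ k] fun ω => pb.vrEstimate i l (x k ω i) (u k ω i) := fun l =>
    h.measurable_vrEstimate i l (hv.measurable_x k i) (hv.measurable_u k i)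
  have hbound : ∀ ω, 1 / (pb.q i : ℝ) * ∑ l, ‖G l ω‖ ^ 2
      ≤ 2 * L ^ 2 * ‖x k ω i - xs‖ ^ 2 + 2 * L ^ 2 * storedDist pb xs i (u k ω i) := fun ω =>
    h.mean_norm_vrEstimate_sub_sq_le hL i xs (x k ω i) (u k ω i)
  have hdom : Integrable (fun ω => 2 * L ^ 2 * ‖x k ω i - xs‖ ^ 2
      + 2 * L ^ 2 * storedDist pb xs i (u k ω i)) P := (hx.const_mul _).add (hst.const_mul _)
  have hsqmeas : ∀ l, Measurable[ℱ k] fun ω => ‖G l ω‖ ^ 2 := fun l =>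
    measurable_norm_sub_sq (hGmeas l) _
  -- A single term is at most q_i times the mean over l, which has an integrable bound.
  have hsqint : ∀ l, Integrable (fun ω => ‖G l ω‖ ^ 2) P := fun l => by
    refine (hdom.const_mul (pb.q i : ℝ)).mono'
      ((hsqmeas l).mono (ℱ.le _) le_rfl).aestronglyMeasurable (Eventually.of_forall fun ω => ?_)
    rw [Real.norm_of_nonneg (by positivity)]
    have h1 := hbound ω
    rw [one_div, inv_mul_le_iff₀ hq] at h1
    refine le_trans ?_ h1
    exact Finset.single_le_sum (f := fun l => ‖G l ω‖ ^ 2) (fun _ _ => by positivity)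
      (Finset.mem_univ l)
  have hinmeas : ∀ l, Measurable[ℱ k] fun ω => (inner ℝ (G l ω) (x k ω i - xs) : ℝ) := fun l =>
    measurable_inner_sub (hGmeas l) (hv.measurable_x k i) _ xs
  have hinint : ∀ l, Integrable (fun ω => (inner ℝ (G l ω) (x k ω i - xs) : ℝ)) P := fun l => by
    refine ((hsqint l).add hx).mono' ((hinmeas l).mono (ℱ.le _) le_rfl).aestronglyMeasurable
      (Eventually.of_forall fun ω => ?_)
    have h1 := norm_inner_le_norm (𝕜 := ℝ) (G l ω) (x k ω i - xs)
    simp only [Pi.add_apply]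
    nlinarith [sq_nonneg (‖G l ω‖ - ‖x k ω i - xs‖), sq_nonneg (‖G l ω‖),
      sq_nonneg (‖x k ω i - xs‖)]
  obtain ⟨h1, h2⟩ := integral_uniform_draw (ℱ.le k) hs' hind hunif hinmeas hinint
  obtain ⟨h3, h4⟩ := integral_uniform_draw (ℱ.le k) hs' hind hunif hsqmeas hsqint
  refine ⟨⟨h1, ?_⟩, h3, ?_⟩
  · rw [h2, ← integral_const_mul, ← integral_const_mul]
    refine integral_mono (hx.const_mul _)
      ((integrable_finsetSum _ fun l _ => hinint l).const_mul _) fun ω => ?_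
    have h5 := h.strong i (x k ω i) xs
    have h6 : 1 / (pb.q i : ℝ) * ∑ l, inner ℝ (G l ω) (x k ω i - xs)
        = inner ℝ (gradient (pb.localObj i) (x k ω i) - gradient (pb.localObj i) xs)
          (x k ω i - xs) := by
      rw [← h.mean_vrEstimate i (x k ω i) (u k ω i), ← sum_inner, hG]
      simp only [Finset.sum_sub_distrib, Finset.sum_const, Finset.card_univ, Fintype.card_fin,
        inner_sub_left, inner_smul_left, conj_trivial, ← Nat.cast_smul_eq_nsmul ℝ]
      field_simp
    simp only [h6]
    exact h5
  · rw [h4, ← integral_const_mul, ← integral_const_mul, ← integral_const_mul,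
      ← integral_add (hx.const_mul _) (hst.const_mul _)]
    exact integral_mono ((integrable_finsetSum _ fun l _ => hsqint l).const_mul _) hdom hbound

end IsVarianceReduced

end Estimator

/-! ### Expected progress -/

section Progress

variable {R B Ω : Type*} [Fintype R] {n : ℕ}
  {pb : CompositeProblem R n} {μi : R → ℝ} {Lil : (i : R) → Fin (pb.q i) → ℝ}
  {Gr : SimpleGraph (R ⊕ B)} {mΩ : MeasurableSpace Ω} {P : Measure Ω}
  {ℱ : Filtration ℕ mΩ} {π : R → ℝ}
  {x : ℕ → Ω → R → EuclideanSpace ℝ (Fin n)} {s : ℕ → Ω → (i : R) → Fin (pb.q i)}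
  {u : ℕ → Ω → (i : R) → Fin (pb.q i) → EuclideanSpace ℝ (Fin n)}

namespace IsVarianceReduced

theorem expected_storedDist_succ_le (hv : IsVarianceReduced pb P ℱ π x s u)
    (xs : EuclideanSpace ℝ (Fin n)) {πmin πmax : ℝ} (hmin : ∀ i, πmin ≤ π i)
    (hmax : ∀ i, π i ≤ πmax) (k : ℕ) (hx : ∀ i, Integrable (fun ω => ‖x k ω i - xs‖ ^ 2) P)
    (hu : ∀ i l, Integrable (fun ω => ‖u k ω i l - xs‖ ^ 2) P) :
    (∀ i l, Integrable (fun ω => ‖u (k + 1) ω i l - xs‖ ^ 2) P) ∧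
      ∫ ω, ∑ i, storedDist pb xs i (u (k + 1) ω i) ∂P ≤
        (1 - πmin) * ∫ ω, ∑ i, storedDist pb xs i (u k ω i) ∂P
        + πmax * ∫ ω, sqDist (x k ω) xs ∂P := by
  have h := fun i => hv.storedDist_succ xs k i (hx i) (hu i)
  refine ⟨fun i => (h i).1, ?_⟩
  have hVsum : ∫ ω, sqDist (x k ω) xs ∂P = ∑ i, ∫ ω, ‖x k ω i - xs‖ ^ 2 ∂P :=
    integral_finsetSum _ fun i _ => hx i
  rw [hVsum, integral_finsetSum _ fun i _ => integrable_storedDist (h i).1,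
    integral_finsetSum _ fun i _ => integrable_storedDist (hu i), Finset.mul_sum, Finset.mul_sum,
    ← Finset.sum_add_distrib]
  refine Finset.sum_le_sum fun i _ => ?_
  rw [(h i).2]
  refine add_le_add (mul_le_mul_of_nonneg_right (by linarith [hmin i]) ?_)
    (mul_le_mul_of_nonneg_right (hmax i) (integral_nonneg fun ω => by positivity))
  exact integral_nonneg fun ω => mul_nonneg (by positivity)
    (Finset.sum_nonneg fun _ _ => by positivity)

variable [LinearOrder R] [Fintype B]

theorem expected_sqDist_succ_le [IsProbabilityMeasure P]
    (hv : IsVarianceReduced pb P ℱ π x s u) (hpb : pb.ConvexSmooth μi Lil) (hn : 1 ≤ n)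
    {xs : EuclideanSpace ℝ (Fin n)} (hxs : pb.IsOptimal xs) (hR : 2 ≤ Fintype.card R)
    (hGr : (reliableGraph Gr).Connected) (hB : 1 ≤ Fintype.card B) {a : ℝ} (ha : 1 ≤ a)
    {g' : EuclideanSpace ℝ (Fin n)} {φ : ℝ} (hφ : 0 < φ) (hφmin : phiMin pb Gr xs g' ≤ φ)
    {μ L γ : ℝ} (hμ : ∀ i, μ ≤ μi i) (hL : ∀ i l, Lil i l ≤ L) (hγ : 0 < γ) {α : ℕ → ℝ}
    {z : ℕ → Ω → R → B → EuclideanSpace ℝ (Fin n)}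
    (hpath : ∀ ω, IsProxDBROPath pb.g Gr a φ α
      (fun k i => pb.vrEstimate i (s k ω i) (x k ω i) (u k ω i)) (fun k => z k ω) fun k => x k ω)
    (k : ℕ) (hα : 0 < α k) (hx : ∀ i, Integrable (fun ω => ‖x k ω i - xs‖ ^ 2) P)
    (hu : ∀ i l, Integrable (fun ω => ‖u k ω i l - xs‖ ^ 2) P) :
    (∀ i, Integrable (fun ω => ‖x (k + 1) ω i - xs‖ ^ 2) P) ∧
      ∫ ω, sqDist (x (k + 1) ω) xs ∂P ≤
        (1 - 2 * μ * α k + 5 / 4 * γ * α k + 4 * α k ^ 2 * L ^ 2) * ∫ ω, sqDist (x k ω) xs ∂P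
        + 4 * α k ^ 2 * L ^ 2 * ∫ ω, ∑ i, storedDist pb xs i (u k ω i) ∂P
        + α k * (n * φ ^ 2 * (Fintype.card B : ℝ) ^ 2 * Fintype.card R / γ)
        + α k ^ 2 * (16 * n * φ ^ 2 * (Fintype.card R : ℝ) ^ 3
          + 4 * n * φ ^ 2 * (Fintype.card B : ℝ) ^ 2 * Fintype.card R) := by
  set E : ℝ := n * φ ^ 2 * (Fintype.card B : ℝ) ^ 2 * Fintype.card R / γ
  set Q : ℝ := 16 * n * φ ^ 2 * (Fintype.card R : ℝ) ^ 3
    + 4 * n * φ ^ 2 * (Fintype.card B : ℝ) ^ 2 * Fintype.card R with hQ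
  set A : R → Ω → EuclideanSpace ℝ (Fin n) := fun i ω =>
    pb.vrEstimate i (s k ω i) (x k ω i) (u k ω i) - gradient (pb.localObj i) xs with hA
  have hmom := fun i => hv.estimate_moments hpb hL xs k i (hx i) (hu i)
  have hst : ∀ i, Integrable (fun ω => storedDist pb xs i (u k ω i)) P := fun i =>
    integrable_storedDist (hu i)
  have hV : Integrable (fun ω => sqDist (x k ω) xs) P := integrable_finsetSum _ fun i _ => hx i
  have hin : Integrable (fun ω => ∑ i, inner ℝ (A i ω) (x k ω i - xs)) P :=
    integrable_finsetSum _ fun i _ => (hmom i).1.1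
  have hsq : Integrable (fun ω => ∑ i, ‖A i ω‖ ^ 2) P :=
    integrable_finsetSum _ fun i _ => (hmom i).2.1
  have hstep : ∀ ω, sqDist (x (k + 1) ω) xs ≤ sqDist (x k ω) xs
      - 2 * α k * ∑ i, inner ℝ (A i ω) (x k ω i - xs)
      + α k * (5 / 4 * γ * sqDist (x k ω) xs + E) + α k ^ 2 * (2 * ∑ i, ‖A i ω‖ ^ 2 + Q) := by
    intro ω
    have h1 := (hpath ω).sqDist_succ_le hpb hn hxs hR hGr hB ha hφ hφmin hγ k hα
    rw [hQ, ← add_assoc]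
    exact h1
  have hI1 : Integrable (fun ω => sqDist (x k ω) xs
      - 2 * α k * ∑ i, inner ℝ (A i ω) (x k ω i - xs)) P := hV.sub (hin.const_mul _)
  have hI2 : Integrable (fun ω => α k * (5 / 4 * γ * sqDist (x k ω) xs + E)) P :=
    ((hV.const_mul _).add (integrable_const _)).const_mul _
  have hI3 : Integrable (fun ω => α k ^ 2 * (2 * ∑ i, ‖A i ω‖ ^ 2 + Q)) P :=
    ((hsq.const_mul _).add (integrable_const _)).const_mul _
  have hI12 : Integrable (fun ω => sqDist (x k ω) xs
      - 2 * α k * ∑ i, inner ℝ (A i ω) (x k ω i - xs)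
      + α k * (5 / 4 * γ * sqDist (x k ω) xs + E)) P := hI1.add hI2
  have hI : Integrable (fun ω => sqDist (x k ω) xs
      - 2 * α k * ∑ i, inner ℝ (A i ω) (x k ω i - xs)
      + α k * (5 / 4 * γ * sqDist (x k ω) xs + E) + α k ^ 2 * (2 * ∑ i, ‖A i ω‖ ^ 2 + Q)) P :=
    hI12.add hI3
  have hnext : ∀ i, Integrable (fun ω => ‖x (k + 1) ω i - xs‖ ^ 2) P := fun i => by
    refine hI.mono' ((hv.measurable_normSq_x xs (k + 1) i).mono
      (ℱ.le _) le_rfl).aestronglyMeasurable (Eventually.of_forall fun ω => ?_)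
    rw [Real.norm_of_nonneg (by positivity)]
    refine le_trans ?_ (hstep ω)
    exact Finset.single_le_sum (f := fun i => ‖x (k + 1) ω i - xs‖ ^ 2) (fun _ _ => by positivity)
      (Finset.mem_univ i)
  refine ⟨hnext, ?_⟩
  have hVnext : Integrable (fun ω => sqDist (x (k + 1) ω) xs) P :=
    integrable_finsetSum _ fun i _ => hnext i
  have hmono := integral_mono hVnext hI hstep
  rw [integral_add hI12 hI3, integral_add hI1 hI2, integral_sub hV (hin.const_mul _),
    integral_const_mul, integral_const_mul, integral_const_mul,
    integral_add (hV.const_mul _) (integrable_const _),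
    integral_add (hsq.const_mul _) (integrable_const _), integral_const_mul,
    integral_const_mul] at hmono
  simp only [integral_const, probReal_univ, one_smul] at hmono
  have hVsum : ∫ ω, sqDist (x k ω) xs ∂P = ∑ i, ∫ ω, ‖x k ω i - xs‖ ^ 2 ∂P :=
    integral_finsetSum _ fun i _ => hx i
  have hTsum : ∫ ω, ∑ i, storedDist pb xs i (u k ω i) ∂P
      = ∑ i, ∫ ω, storedDist pb xs i (u k ω i) ∂P := integral_finsetSum _ fun i _ => hst i
  have h1 : μ * ∫ ω, sqDist (x k ω) xs ∂P ≤ ∫ ω, ∑ i, inner ℝ (A i ω) (x k ω i - xs) ∂P := by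
    rw [hVsum, Finset.mul_sum, integral_finsetSum _ fun i _ => (hmom i).1.1]
    refine Finset.sum_le_sum fun i _ => le_trans ?_ (hmom i).1.2
    exact mul_le_mul_of_nonneg_right (hμ i) (integral_nonneg fun ω => by positivity)
  have h2 : ∫ ω, ∑ i, ‖A i ω‖ ^ 2 ∂P ≤ 2 * L ^ 2 * ∫ ω, sqDist (x k ω) xs ∂P
      + 2 * L ^ 2 * ∫ ω, ∑ i, storedDist pb xs i (u k ω i) ∂P := by
    rw [hVsum, hTsum, integral_finsetSum _ fun i _ => (hmom i).2.1, Finset.mul_sum,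
      Finset.mul_sum, ← Finset.sum_add_distrib]
    exact Finset.sum_le_sum fun i _ => (hmom i).2.2
  have h3 := mul_le_mul_of_nonneg_left h1 hα.le
  have h4 := mul_le_mul_of_nonneg_left h2 (sq_nonneg (α k))
  linarith

/-- A sequence `Z` that decays slowly enough dominates the expected squared distance. -/
theorem expected_sqDist_le [IsProbabilityMeasure P]
    (hv : IsVarianceReduced pb P ℱ π x s u) (hpb : pb.ConvexSmooth μi Lil) (hn : 1 ≤ n)
    {xs : EuclideanSpace ℝ (Fin n)} (hxs : pb.IsOptimal xs) (hR : 2 ≤ Fintype.card R)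
    (hGr : (reliableGraph Gr).Connected) (hB : 1 ≤ Fintype.card B) {a : ℝ} (ha : 1 ≤ a)
    {g' : EuclideanSpace ℝ (Fin n)} {φ : ℝ} (hφ : 0 < φ) (hφmin : phiMin pb Gr xs g' ≤ φ)
    {x0 : R → EuclideanSpace ℝ (Fin n)} (hx0 : ∀ ω, x 0 ω = x0)
    {μ L γ : ℝ} (hμ : ∀ i, μ ≤ μi i) (hL : ∀ i l, Lil i l ≤ L) (hγ : 0 < γ) (hγμ : γ ≤ μ)
    {κ πmax : ℝ} (hκ : 1 ≤ κ) (hπmax : 0 ≤ πmax) (hκπ : πmax / κ ≤ 1)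
    (hmin : ∀ i, πmax / κ ≤ π i) (hmax : ∀ i, π i ≤ πmax)
    {α : ℕ → ℝ} (hα : ∀ k, 0 < α k) (hαL : ∀ k, 32 * (α k * κ * L ^ 2) ≤ γ)
    (hαγ : ∀ k, γ * α k ≤ 1)
    {z : ℕ → Ω → R → B → EuclideanSpace ℝ (Fin n)}
    (hpath : ∀ ω, IsProxDBROPath pb.g Gr a φ α
      (fun k i => pb.vrEstimate i (s k ω i) (x k ω i) (u k ω i)) (fun k => z k ω) fun k => x k ω)
    {Z : ℕ → ℝ} (hZnn : ∀ k, 0 ≤ Z k) (hZ0 : sqDist x0 xs ≤ Z 0)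
    (hZstep : ∀ k, (1 - γ / 4 * α k) * Z k
        + α k * (n * φ ^ 2 * (Fintype.card B : ℝ) ^ 2 * Fintype.card R / γ)
        + α k ^ 2 * (16 * n * φ ^ 2 * (Fintype.card R : ℝ) ^ 3
          + 4 * n * φ ^ 2 * (Fintype.card B : ℝ) ^ 2 * Fintype.card R) ≤ Z (k + 1))
    (hZslow : ∀ k, (1 - πmax / κ / 4) * Z k ≤ Z (k + 1)) (k : ℕ) :
    Integrable (fun ω => sqDist (x k ω) xs) P ∧ ∫ ω, sqDist (x k ω) xs ∂P ≤ Z k := by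
  -- The factor 4/3 closes the stored-point recursion: with p = πmax/κ, (1 - p)(4/3)κ + κp =
  -- (4/3)κ(1 - p/4), and `hZslow` absorbs the factor 1 - p/4.
  suffices h : (∀ i, Integrable (fun ω => ‖x k ω i - xs‖ ^ 2) P) ∧
      (∀ i l, Integrable (fun ω => ‖u k ω i l - xs‖ ^ 2) P) ∧
      ∫ ω, sqDist (x k ω) xs ∂P ≤ Z k ∧
      ∫ ω, ∑ i, storedDist pb xs i (u k ω i) ∂P ≤ 4 / 3 * κ * Z k from
    ⟨integrable_finsetSum _ fun i _ => h.1 i, h.2.2.1⟩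
  have hκ0 : 0 < κ := by linarith
  induction k with
  | zero =>
    have hst : ∀ i, storedDist pb xs i (fun _ => x0 i) = ‖x0 i - xs‖ ^ 2 := fun i => by
      have hq : (pb.q i : ℝ) ≠ 0 := by have := pb.q_pos i; positivity
      simp [storedDist, hq]
    have hu0 : ∀ ω i, u 0 ω i = fun _ => x0 i := fun ω i => by
      funext l; rw [hv.init, hx0]
    simp only [hx0, hu0, hst]
    refine ⟨fun i => integrable_const _, fun i l => integrable_const _, ?_, ?_⟩
    · simpa using hZ0
    · have h1 : ∑ i, ‖x0 i - xs‖ ^ 2 ≤ Z 0 := hZ0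
      simp only [integral_const, probReal_univ, one_smul]
      have := hZnn 0
      nlinarith
  | succ k ih =>
    obtain ⟨hx, hu, hVk, hTk⟩ := ih
    obtain ⟨hx', hV'⟩ := hv.expected_sqDist_succ_le hpb hn hxs hR hGr hB ha hφ hφmin hμ hL hγ hpath
      k (hα k) hx hu
    obtain ⟨hu', hT'⟩ := hv.expected_storedDist_succ_le xs hmin hmax k hx hu
    set V := ∫ ω, sqDist (x k ω) xs ∂P
    set T := ∫ ω, ∑ i, storedDist pb xs i (u k ω i) ∂P
    have hZk := hZnn k
    have hak := hα k
    have haL := hαL k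
    refine ⟨hx', hu', hV'.trans (le_trans ?_ (hZstep k)), hT'.trans ?_⟩
    · have h1 : 0 ≤ α k * L ^ 2 := by positivity
      have h2 : 32 * (α k * L ^ 2) ≤ γ := by
        have : α k * L ^ 2 * 1 ≤ α k * L ^ 2 * κ := mul_le_mul_of_nonneg_left hκ h1
        linarith
      have h3 : α k * (32 * (α k * L ^ 2)) ≤ α k * γ := mul_le_mul_of_nonneg_left h2 hak.le
      have h4 : α k * (32 * (α k * κ * L ^ 2)) ≤ α k * γ := mul_le_mul_of_nonneg_left haL hak.le
      have h5 : α k * γ ≤ α k * μ := mul_le_mul_of_nonneg_left hγμ hak.le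
      have h6 : 4 * α k ^ 2 * L ^ 2 * T ≤ 4 * α k ^ 2 * L ^ 2 * (4 / 3 * κ * Z k) :=
        mul_le_mul_of_nonneg_left hTk (by positivity)
      have h7 : 4 * α k ^ 2 * L ^ 2 * (4 / 3 * κ * Z k) ≤ 1 / 6 * (α k * γ) * Z k := by
        have := mul_le_mul_of_nonneg_right h4 hZk
        linarith
      have hV0 : 0 ≤ V := integral_nonneg fun ω => Finset.sum_nonneg fun _ _ => by positivity
      have h8 : (1 - 2 * μ * α k + 5 / 4 * γ * α k + 4 * α k ^ 2 * L ^ 2) * V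
          ≤ (1 - 5 / 8 * (α k * γ)) * V := mul_le_mul_of_nonneg_right (by linarith) hV0
      have h9 : (1 - 5 / 8 * (α k * γ)) * V ≤ (1 - 5 / 8 * (α k * γ)) * Z k :=
        mul_le_mul_of_nonneg_left hVk (by linarith [hαγ k])
      have h10 : 0 ≤ α k * γ * Z k := by positivity
      linarith
    · set p := πmax / κ with hp
      have hpκ : πmax = κ * p := by rw [hp]; field_simp
      have hp0 : 0 ≤ p := by positivity
      have h1 : (1 - p) * T ≤ (1 - p) * (4 / 3 * κ * Z k) :=
        mul_le_mul_of_nonneg_left hTk (by linarith)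
      have h2 : κ * p * V ≤ κ * p * Z k := mul_le_mul_of_nonneg_left hVk (by positivity)
      have h3 := mul_le_mul_of_nonneg_left (hZslow k) (by positivity : 0 ≤ 4 / 3 * κ)
      rw [hpκ]
      linarith

end IsVarianceReduced

end Progress

/-! ### The two algorithms -/

section Algorithms

variable {R B Ω : Type*} {n : ℕ} {pb : CompositeProblem R n}

theorem CompositeProblem.qmin_le (pb : CompositeProblem R n) (i : R) : pb.qmin ≤ pb.q i :=
  Nat.sInf_le ⟨i, rfl⟩

theorem CompositeProblem.le_qmax [Finite R] (pb : CompositeProblem R n) (i : R) : pb.q i ≤ pb.qmax :=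
  le_ciSup (Set.finite_range pb.q).bddAbove i

theorem CompositeProblem.qmin_pos [Nonempty R] (pb : CompositeProblem R n) : 0 < pb.qmin := by
  obtain ⟨i, hi⟩ := Nat.sInf_mem (Set.range_nonempty pb.q)
  have : pb.q i = pb.qmin := hi
  rw [← this]
  exact pb.q_pos i

variable [Fintype R] [Fintype B] {Gr : SimpleGraph (R ⊕ B)} {mΩ : MeasurableSpace Ω} {P : Measure Ω}
  {ℱ : Filtration ℕ mΩ} {a φ : ℝ} {α : ℕ → ℝ} {x0 : R → EuclideanSpace ℝ (Fin n)}
  {x : ℕ → Ω → R → EuclideanSpace ℝ (Fin n)}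

theorem IsProxDBROSaga.exists_isVarianceReduced (h : IsProxDBROSaga pb Gr a φ α x0 P ℱ x) :
    ∃ s u, ∃ z : ℕ → Ω → R → B → EuclideanSpace ℝ (Fin n),
      IsVarianceReduced pb P ℱ (fun i => 1 / (pb.q i : ℝ)) x s u ∧
      ∀ ω, IsProxDBROPath pb.g Gr a φ α
        (fun k i => pb.vrEstimate i (s k ω i) (x k ω i) (u k ω i)) (fun k => z k ω)
        fun k => x k ω := by
  obtain ⟨-, hx, s, z, hs, hpath⟩ := h
  refine ⟨s, fun k ω => pb.sagaTable (fun k => x k ω) (fun k => s k ω) k, z,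
    ⟨hx, hs, fun ω i l => rfl, fun k i l => ?_⟩, hpath⟩
  obtain ⟨hmeas, hind, hunif⟩ := hs k i
  -- In SAGA the point l is refreshed exactly when l is drawn, with probability 1/q_i.
  refine ⟨(fun ω => s k ω i) ⁻¹' {l}, hmeas (measurableSet_singleton l), fun h hh => ?_, fun ω => ?_⟩
  · rw [integral_indicator_preimage_of_indep (ℱ.le k) (hmeas.mono (ℱ.le _) le_rfl)
      (measurableSet_singleton l) hind hh, ← hunif l]
    rfl
  · simp only [CompositeProblem.sagaTable, Set.mem_preimage, Set.mem_singleton_iff]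
    exact ⟨fun h => if_pos h.symm, fun h => if_neg fun h' => h h'.symm⟩

theorem IsProxDBROLsvrg.exists_isVarianceReduced (h : IsProxDBROLsvrg pb Gr a φ α x0 P ℱ x) :
    ∃ π s u, ∃ z : ℕ → Ω → R → B → EuclideanSpace ℝ (Fin n),
      (∀ i, 1 / (pb.qmax : ℝ) ≤ π i ∧ π i ≤ 1 / (pb.qmin : ℝ)) ∧
      IsVarianceReduced pb P ℱ π x s u ∧
      ∀ ω, IsProxDBROPath pb.g Gr a φ α
        (fun k i => pb.vrEstimate i (s k ω i) (x k ω i) (u k ω i)) (fun k => z k ω)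
        fun k => x k ω := by
  obtain ⟨-, hx, p, s, c, z, hp, hs, hc, hpath⟩ := h
  refine ⟨p, s, fun k ω i _ => lsvrgPoint (fun k => x k ω) (fun k => c k ω) k i, z, hp,
    ⟨hx, hs, fun ω i l => rfl, fun k i l => ?_⟩, hpath⟩
  obtain ⟨hmeas, hind, hprob⟩ := hc k i
  refine ⟨(fun ω => c k ω i) ⁻¹' {true}, hmeas (measurableSet_singleton true), fun h hh => ?_,
    fun ω => ?_⟩
  · rw [integral_indicator_preimage_of_indep (ℱ.le k) (hmeas.mono (ℱ.le _) le_rfl)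
      (measurableSet_singleton true) hind hh, ← hprob]
    rfl
  · simp only [lsvrgPoint, Set.mem_preimage, Set.mem_singleton_iff]
    exact ⟨fun h => if_pos h, fun h => if_neg h⟩

/-- Both algorithms are variance-reduced schemes with refresh probabilities between `1 / qmax` and
`1 / qmin`. -/
theorem exists_isVarianceReduced [Nonempty R]
    (h : IsProxDBROSaga pb Gr a φ α x0 P ℱ x ∨ IsProxDBROLsvrg pb Gr a φ α x0 P ℱ x) :
    (∀ ω, x 0 ω = x0) ∧ ∃ π s u, ∃ z : ℕ → Ω → R → B → EuclideanSpace ℝ (Fin n),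
      (∀ i, 1 / (pb.qmax : ℝ) ≤ π i ∧ π i ≤ 1 / (pb.qmin : ℝ)) ∧
      IsVarianceReduced pb P ℱ π x s u ∧
      ∀ ω, IsProxDBROPath pb.g Gr a φ α
        (fun k i => pb.vrEstimate i (s k ω i) (x k ω i) (u k ω i)) (fun k => z k ω)
        fun k => x k ω := by
  rcases h with h | h
  · obtain ⟨s, u, z, h1, h2⟩ := h.exists_isVarianceReduced
    refine ⟨h.1, _, s, u, z, fun i => ⟨?_, ?_⟩, h1, h2⟩
    · exact one_div_le_one_div_of_le (by exact_mod_cast pb.q_pos i)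
        (by exact_mod_cast pb.le_qmax i)
    · exact one_div_le_one_div_of_le (by exact_mod_cast pb.qmin_pos)
        (by exact_mod_cast pb.qmin_le i)
  · exact ⟨h.1, h.exists_isVarianceReduced⟩

end Algorithms

/-! ### Convergence rates -/

/-- Consequences of the step size condition. -/
theorem step_size_bounds {μ L γ κf κq qmin α : ℝ} (hμ : 0 < μ) (hL : 0 < L) (hκf : κf = L / μ)
    (hγ : γ = μ * L / (μ + L)) (hκq : 1 ≤ κq) (hqmin : 1 ≤ qmin) (hα : 0 < α)
    (hαle : α * (κq * (32 * (1 + κf) ^ 2 + qmin) * μ) ≤ 1) :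
    32 * (α * κq * L ^ 2) ≤ γ ∧ γ * α ≤ 1 ∧ γ * α * (κq * qmin) ≤ 1 := by
  have hγ0 : 0 < γ := by rw [hγ]; positivity
  have hγμ : γ ≤ μ := by
    rw [hγ, div_le_iff₀ (by positivity)]
    nlinarith
  -- This identity converts the factor (1 + κf)² of the step size condition into L²/γ².
  have hLγ : γ * (1 + κf) = L := by
    rw [hγ, hκf]
    field_simp
  have h1 : α * κq * μ * (32 * (1 + κf) ^ 2) ≤ 1 := by
    have : 0 ≤ α * κq * μ * qmin := by positivity
    linarith
  have h2 : α * μ * (κq * qmin) ≤ 1 := by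
    have : 0 ≤ α * κq * μ * (32 * (1 + κf) ^ 2) := by positivity
    linarith
  have h3 : γ * α * (κq * qmin) ≤ 1 := by
    have : γ * (α * (κq * qmin)) ≤ μ * (α * (κq * qmin)) :=
      mul_le_mul_of_nonneg_right hγμ (by positivity)
    linarith
  refine ⟨?_, ?_, h3⟩
  · have h4 : 32 * (α * κq * L ^ 2) * μ ≤ γ * μ := by
      calc 32 * (α * κq * L ^ 2) * μ = α * κq * μ * (32 * (1 + κf) ^ 2) * γ ^ 2 := by
            rw [← hLγ]; ring
        _ ≤ 1 * γ ^ 2 := mul_le_mul_of_nonneg_right h1 (by positivity)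
        _ ≤ γ * μ := by nlinarith
    exact le_of_mul_le_mul_right h4 hμ
  · have h5 : 1 ≤ κq * qmin := by nlinarith
    have h6 : 0 ≤ γ * α := by positivity
    nlinarith

theorem corollary1 {R B Ω : Type*} [Fintype R] [LinearOrder R] [Fintype B]
    {mΩ : MeasurableSpace Ω} (P : Measure Ω) [IsProbabilityMeasure P] (ℱ : Filtration ℕ mΩ)
    (n : ℕ) (hn : 1 ≤ n)
    -- the problem: strongly convex local objectives, smooth components, convex `g`
    (pb : CompositeProblem R n) (μi : R → ℝ) (Lil : (i : R) → Fin (pb.q i) → ℝ)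
    (hpb : pb.ConvexSmooth μi Lil)
    (xs : EuclideanSpace ℝ (Fin n)) (hxs : pb.IsOptimal xs)
    -- the network: at least two reliable agents, connected among themselves
    (Gr : SimpleGraph (R ⊕ B)) (hR : 2 ≤ Fintype.card R) (hGr : (reliableGraph Gr).Connected)
    -- the proportion of Byzantine agents
    (ra : ℝ) (hra : 0 < ra) (hB : (Fintype.card B : ℝ) = ra * (Fintype.card R : ℝ))
    -- the norm exponent, the penalty parameter and the starting points
    (a : ℝ) (ha : 1 ≤ a)
    (g' : EuclideanSpace ℝ (Fin n)) (hg' : g' ∈ subdifferential pb.g xs)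
    (φ : ℝ) (hφ : 0 < φ) (hφmin : phiMin pb Gr xs g' ≤ φ)
    (x0 : R → EuclideanSpace ℝ (Fin n))
    -- the constants derived from the problem
    (μ L κf γ : ℝ) (hμ : μ = ⨅ i, μi i) (hL : L = ⨆ p : (i : R) × Fin (pb.q i), Lil p.1 p.2)
    (hκf : κf = L / μ) (hγ : γ = μ * L / (μ + L)) :
    -- linear convergence with a constant step size
    (∀ α : ℝ, 0 < α →
      α ≤ 1 / (pb.kappaQ * (32 * (1 + κf) ^ 2 + (pb.qmin : ℝ)) * μ) →
      (0 < 1 - γ / 4 * α ∧ 1 - γ / 4 * α < 1) ∧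
      ∀ x : ℕ → Ω → R → EuclideanSpace ℝ (Fin n),
        (IsProxDBROSaga pb Gr a φ (fun _ => α) x0 P ℱ x ∨
          IsProxDBROLsvrg pb Gr a φ (fun _ => α) x0 P ℱ x) →
        ∀ k : ℕ, Integrable (fun ω => sqDist (x k ω) xs) P ∧
          ∫ ω, sqDist (x k ω) xs ∂P ≤
            (1 - γ / 4 * α) ^ k *
              (sqDist x0 xs
                + (pb.qmin : ℝ) * γ * α * pb.gradLearn xs (fun i _ => x0 i)
                  / ((pb.qmax : ℝ) * L))
            + 4 * (n : ℝ) * (4 * α * ((4 + ra ^ 2) / γ) + (ra / γ) ^ 2) * φ ^ 2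
                * (Fintype.card R : ℝ) ^ 3) ∧
    -- sublinear convergence with a decaying step size, for `g` with bounded subgradients
    (∀ Ghat : ℝ, 0 < Ghat → (∀ y, ∀ v ∈ subdifferential pb.g y, ‖v‖ ^ 2 ≤ Ghat) →
      ∀ θ ξ : ℝ, 4 / γ < θ →
      ξ = pb.kappaQ * (64 * (1 + κf) ^ 2 + (pb.qmin : ℝ)) * μ * θ →
      ∀ x : ℕ → Ω → R → EuclideanSpace ℝ (Fin n),
        (IsProxDBROSaga pb Gr a φ (fun k => θ / ((k : ℝ) + ξ)) x0 P ℱ x ∨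
          IsProxDBROLsvrg pb Gr a φ (fun k => θ / ((k : ℝ) + ξ)) x0 P ℱ x) →
        ∀ k : ℕ, Integrable (fun ω => sqDist (x k ω) xs) P ∧
          ∫ ω, sqDist (x k ω) xs ∂P ≤
            max (θ ^ 2 * (16 * (Fintype.card R : ℝ) * Ghat
                  + 4 * (n : ℝ) * φ ^ 2 * (Fintype.card R : ℝ) ^ 3 * (4 + ra ^ 2))
                / (γ * θ / 4 - 1))
              (ξ * sqDist x0 xs) / ((k : ℝ) + ξ)
            + 4 * (n : ℝ) * (ra / γ) ^ 2 * φ ^ 2 * (Fintype.card R : ℝ) ^ 3) := by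
  classical
  have hne : Nonempty R := Fintype.card_pos_iff.1 (by omega)
  have hr : (0 : ℝ) < Fintype.card R := by exact_mod_cast (by omega : 0 < Fintype.card R)
  have hn0 : (0 : ℝ) < n := by exact_mod_cast hn
  have hBcard : 1 ≤ Fintype.card B := by
    have : (0 : ℝ) < Fintype.card B := by rw [hB]; positivity
    exact_mod_cast this
  have hμle : ∀ i, μ ≤ μi i := fun i => by
    rw [hμ]; exact ciInf_le (Set.finite_range μi).bddBelow i
  have hLle : ∀ i l, Lil i l ≤ L := fun i l => by
    rw [hL]
    exact le_ciSup (f := fun p : (i : R) × Fin (pb.q i) => Lil p.1 p.2)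
      (Set.finite_range _).bddAbove ⟨i, l⟩
  have hμ0 : 0 < μ := by
    obtain ⟨i, hi⟩ := exists_eq_ciInf_of_finite (f := μi)
    rw [hμ, ← hi]
    exact hpb.mu_pos i
  have hL0 : 0 < L := by
    obtain ⟨i⟩ := hne
    exact (hpb.mu_pos i).trans_le (hpb.mu_le hn hLle i)
  have hγ0 : 0 < γ := by rw [hγ]; positivity
  have hκf0 : 0 < κf := by rw [hκf]; positivity
  have hγμ : γ ≤ μ := by
    rw [hγ, div_le_iff₀ (by positivity)]
    nlinarith
  have hqmin1 : (1 : ℝ) ≤ pb.qmin := by exact_mod_cast pb.qmin_pos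
  have hqle : (pb.qmin : ℝ) ≤ pb.qmax := by
    obtain ⟨i⟩ := hne
    exact_mod_cast (pb.qmin_le i).trans (pb.le_qmax i)
  have hκq : 1 ≤ pb.kappaQ := by
    rw [CompositeProblem.kappaQ, one_le_div (by linarith)]
    exact hqle
  have hqmax : pb.kappaQ * pb.qmin = pb.qmax := by
    rw [CompositeProblem.kappaQ, div_mul_cancel₀ _ (by positivity)]
  have hπ : 1 / (pb.qmin : ℝ) / pb.kappaQ = 1 / (pb.qmax : ℝ) := by
    rw [div_div, mul_comm, hqmax]
  have hβ : n * φ ^ 2 * (Fintype.card B : ℝ) ^ 2 * Fintype.card R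
      = n * φ ^ 2 * ra ^ 2 * (Fintype.card R : ℝ) ^ 3 := by
    rw [hB]; ring
  have hβ4 : 4 * n * φ ^ 2 * (Fintype.card B : ℝ) ^ 2 * Fintype.card R
      = 4 * n * φ ^ 2 * ra ^ 2 * (Fintype.card R : ℝ) ^ 3 := by
    rw [hB]; ring
  have hV0 : 0 ≤ sqDist x0 xs := Finset.sum_nonneg fun _ _ => by positivity
  -- the common induction
  have main : ∀ α : ℕ → ℝ, (∀ k, 0 < α k) →
      (∀ k, α k * (pb.kappaQ * (32 * (1 + κf) ^ 2 + (pb.qmin : ℝ)) * μ) ≤ 1) →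
      ∀ x : ℕ → Ω → R → EuclideanSpace ℝ (Fin n),
        (IsProxDBROSaga pb Gr a φ α x0 P ℱ x ∨ IsProxDBROLsvrg pb Gr a φ α x0 P ℱ x) →
      ∀ Z : ℕ → ℝ, (∀ k, 0 ≤ Z k) → sqDist x0 xs ≤ Z 0 →
      (∀ k, (1 - γ / 4 * α k) * Z k
        + α k * (n * φ ^ 2 * ra ^ 2 * (Fintype.card R : ℝ) ^ 3 / γ)
        + α k ^ 2 * (16 * n * φ ^ 2 * (Fintype.card R : ℝ) ^ 3
          + 4 * n * φ ^ 2 * ra ^ 2 * (Fintype.card R : ℝ) ^ 3) ≤ Z (k + 1)) →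
      (∀ k, (1 - 1 / (pb.qmax : ℝ) / 4) * Z k ≤ Z (k + 1)) →
      ∀ k, Integrable (fun ω => sqDist (x k ω) xs) P ∧ ∫ ω, sqDist (x k ω) xs ∂P ≤ Z k := by
    intro α hα hαle x hx Z hZnn hZ0 hZstep hZslow
    obtain ⟨hx0, π, s, u, z, hπb, hv, hpath⟩ := exists_isVarianceReduced hx
    have hb := fun k => step_size_bounds hμ0 hL0 hκf hγ hκq hqmin1 (hα k) (hαle k)
    refine hv.expected_sqDist_le hpb hn hxs hR hGr hBcard ha hφ hφmin hx0 hμle hLle hγ0 hγμ hκq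
      (πmax := 1 / (pb.qmin : ℝ)) (by positivity) ?_ ?_ (fun i => (hπb i).2) hα (fun k => (hb k).1)
      (fun k => (hb k).2.1) hpath hZnn hZ0 ?_ ?_
    · rw [hπ, div_le_one (by linarith)]; linarith
    · rw [hπ]; exact fun i => (hπb i).1
    · rw [hβ, hβ4]; exact hZstep
    · rw [hπ]; exact hZslow
  have hKpos : 0 < pb.kappaQ * (32 * (1 + κf) ^ 2 + (pb.qmin : ℝ)) * μ := by positivity
  refine ⟨fun α hα hαle => ?_, fun Ghat hGhat _ θ ξ hθ hξ x hx k => ?_⟩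
  · rw [le_div_iff₀ hKpos] at hαle
    obtain ⟨-, hb2, hb3⟩ := step_size_bounds hμ0 hL0 hκf hγ hκq hqmin1 hα hαle
    rw [hqmax] at hb3
    have hγα : 0 < γ * α := by positivity
    refine ⟨⟨by linarith, by linarith⟩, fun x hx k => ?_⟩
    have hρ0 : 0 ≤ 1 - γ / 4 * α := by linarith
    have ht0 := hpb.gradLearn_const_nonneg xs x0
    have hU0 : sqDist x0 xs ≤ sqDist x0 xs
        + (pb.qmin : ℝ) * γ * α * pb.gradLearn xs (fun i _ => x0 i) / ((pb.qmax : ℝ) * L) :=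
      le_add_of_nonneg_right (by positivity)
    set U := sqDist x0 xs
        + (pb.qmin : ℝ) * γ * α * pb.gradLearn xs (fun i _ => x0 i) / ((pb.qmax : ℝ) * L)
    set D := 4 * (n : ℝ) * (4 * α * ((4 + ra ^ 2) / γ) + (ra / γ) ^ 2) * φ ^ 2
                * (Fintype.card R : ℝ) ^ 3 with hD
    have hD0 : 0 ≤ D := by positivity
    have hU : 0 ≤ U := hV0.trans hU0
    -- D is the fixed point of the affine recursion, so geometric decay plus D satisfies it with
    -- equality.
    have hDeq : γ / 4 * α * D = α * (n * φ ^ 2 * ra ^ 2 * (Fintype.card R : ℝ) ^ 3 / γ)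
        + α ^ 2 * (16 * n * φ ^ 2 * (Fintype.card R : ℝ) ^ 3
          + 4 * n * φ ^ 2 * ra ^ 2 * (Fintype.card R : ℝ) ^ 3) := by
      rw [hD]
      field_simp
      ring
    refine main (fun _ => α) (fun _ => hα) (fun _ => hαle) x hx
      (fun k => (1 - γ / 4 * α) ^ k * U + D) (fun k => by positivity) (by simp; linarith)
      (fun k => ?_) (fun k => ?_) k
    · have : (1 - γ / 4 * α) ^ (k + 1) * U = (1 - γ / 4 * α) * ((1 - γ / 4 * α) ^ k * U) := by ring
      simp only [this]
      linarith
    · have h1 : (1 - γ / 4 * α) ^ (k + 1) * U = (1 - γ / 4 * α) * ((1 - γ / 4 * α) ^ k * U) := by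
        ring
      -- The summand qmin in the step size bound serves this: the rate 1 - γα/4 is no faster than 1
      -- - 1/(4 qmax).
      have h2 : γ * α ≤ 1 / (pb.qmax : ℝ) := by rwa [le_div_iff₀ (by linarith)]
      have h3 : 0 ≤ (1 - γ / 4 * α) ^ k * U := by positivity
      have h4 := mul_le_mul_of_nonneg_right h2 h3
      have h5 : 0 ≤ 1 / (pb.qmax : ℝ) := by positivity
      have h6 := mul_nonneg h5 hD0
      simp only [h1]
      linarith
  · have hθγ : 4 < γ * θ := by
      have := hθ
      rw [div_lt_iff₀ hγ0] at this
      linarith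
    have hθ0 : 0 < θ := lt_trans (by positivity) hθ
    have hξ0 : 0 < ξ := by rw [hξ]; positivity
    have hs : ∀ k : ℕ, 0 < (k : ℝ) + ξ := fun k => by positivity
    have hξK : θ * (pb.kappaQ * (32 * (1 + κf) ^ 2 + (pb.qmin : ℝ)) * μ) ≤ ξ := by
      have : 0 ≤ pb.kappaQ * (32 * (1 + κf) ^ 2) * μ * θ := by positivity
      rw [hξ]
      linarith
    -- Since μθ ≥ γθ > 4 and κ_q qmin = qmax. It ensures that 1/(k+ξ) decays slowly enough relative
    -- to the refresh rate.
    have hξq : 4 * (pb.qmax : ℝ) ≤ ξ := by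
      have h1 : 0 ≤ pb.kappaQ * (64 * (1 + κf) ^ 2) * μ * θ := by positivity
      have h2 : ξ = pb.kappaQ * (64 * (1 + κf) ^ 2) * μ * θ + pb.qmax * (μ * θ) := by
        rw [hξ, ← hqmax]; ring
      have h3 : 4 ≤ μ * θ := hθγ.le.trans (mul_le_mul_of_nonneg_right hγμ hθ0.le)
      have h4 : (pb.qmax : ℝ) * 4 ≤ pb.qmax * (μ * θ) := mul_le_mul_of_nonneg_left h3 (by positivity)
      linarith
    set Q := 16 * n * φ ^ 2 * (Fintype.card R : ℝ) ^ 3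
          + 4 * n * φ ^ 2 * ra ^ 2 * (Fintype.card R : ℝ) ^ 3 with hQ
    set Ξ := max (θ ^ 2 * (16 * (Fintype.card R : ℝ) * Ghat
                  + 4 * (n : ℝ) * φ ^ 2 * (Fintype.card R : ℝ) ^ 3 * (4 + ra ^ 2))
                / (γ * θ / 4 - 1))
              (ξ * sqDist x0 xs) with hΞ
    set D := 4 * (n : ℝ) * (ra / γ) ^ 2 * φ ^ 2 * (Fintype.card R : ℝ) ^ 3 with hD
    have hD0 : 0 ≤ D := by positivity
    have hΞ0 : 0 ≤ Ξ := le_max_of_le_right (by positivity)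
    have hΞQ : θ ^ 2 * Q ≤ (γ * θ / 4 - 1) * Ξ := by
      have h1 := le_max_left (θ ^ 2 * (16 * (Fintype.card R : ℝ) * Ghat
                  + 4 * (n : ℝ) * φ ^ 2 * (Fintype.card R : ℝ) ^ 3 * (4 + ra ^ 2))
                / (γ * θ / 4 - 1)) (ξ * sqDist x0 xs)
      rw [← hΞ, div_le_iff₀ (by linarith)] at h1
      have h2 : θ ^ 2 * Q ≤ θ ^ 2 * (16 * (Fintype.card R : ℝ) * Ghat
                  + 4 * (n : ℝ) * φ ^ 2 * (Fintype.card R : ℝ) ^ 3 * (4 + ra ^ 2)) := by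
        refine mul_le_mul_of_nonneg_left ?_ (sq_nonneg _)
        have : 0 ≤ 16 * (Fintype.card R : ℝ) * Ghat := by positivity
        rw [hQ]
        linarith
      linarith
    refine main (fun k => θ / ((k : ℝ) + ξ)) (fun k => div_pos hθ0 (hs k)) (fun k => ?_) x hx
      (fun k => Ξ / ((k : ℝ) + ξ) + D) (fun k => ?_) ?_ (fun k => ?_) (fun k => ?_) k
    · rw [div_mul_eq_mul_div, div_le_one (hs k)]
      have : (0 : ℝ) ≤ k := by positivity
      linarith
    · have := hs k
      positivity
    · have h1 : sqDist x0 xs ≤ Ξ / ξ := by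
        rw [le_div_iff₀ hξ0, mul_comm]
        exact le_max_right _ _
      simp only [Nat.cast_zero, zero_add]
      linarith
    · have hsk := hs k
      set t : ℝ := (k : ℝ) + ξ with ht
      have ht1 : ((k + 1 : ℕ) : ℝ) + ξ = t + 1 := by rw [ht]; push_cast; ring
      simp only [ht1]
      have h1 : θ / t * (n * φ ^ 2 * ra ^ 2 * (Fintype.card R : ℝ) ^ 3 / γ)
          = γ / 4 * (θ / t) * D := by
        rw [hD]
        field_simp
      -- Equivalent to `hΞQ`, the reason for the denominator γθ/4 - 1 in Ξ. The constant D has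
      -- already absorbed the noise of order α.
      have h2 : (1 - γ / 4 * (θ / t)) * (Ξ / t) + (θ / t) ^ 2 * Q ≤ Ξ / t - Ξ / t ^ 2 := by
        have h3 : (1 - γ / 4 * (θ / t)) * (Ξ / t) + (θ / t) ^ 2 * Q - (Ξ / t - Ξ / t ^ 2)
            = (θ ^ 2 * Q - (γ * θ / 4 - 1) * Ξ) / t ^ 2 := by
          field_simp
          ring
        have h4 : (θ ^ 2 * Q - (γ * θ / 4 - 1) * Ξ) / t ^ 2 ≤ 0 :=
          div_nonpos_of_nonpos_of_nonneg (by linarith) (by positivity)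
        linarith
      have h5 : Ξ / t - Ξ / t ^ 2 ≤ Ξ / (t + 1) := by
        have h6 : Ξ / (t + 1) - (Ξ / t - Ξ / t ^ 2) = Ξ / (t ^ 2 * (t + 1)) := by
          field_simp
          ring
        have h7 : 0 ≤ Ξ / (t ^ 2 * (t + 1)) := by positivity
        linarith
      linarith
    · have hsk := hs k
      have hξk : ξ ≤ (k : ℝ) + ξ := by
        have : (0 : ℝ) ≤ k := by positivity
        linarith
      set t : ℝ := (k : ℝ) + ξ with ht
      have ht1 : ((k + 1 : ℕ) : ℝ) + ξ = t + 1 := by rw [ht]; push_cast; ring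
      simp only [ht1]
      have h1 : 1 / (t + 1) ≤ 1 / (pb.qmax : ℝ) / 4 := by
        rw [div_div]
        exact one_div_le_one_div_of_le (by linarith) (by linarith)
      have h2 : Ξ / (t + 1) = (1 - 1 / (t + 1)) * (Ξ / t) := by
        field_simp
        ring
      have h3 : 0 ≤ Ξ / t := by positivity
      have h4 := mul_le_mul_of_nonneg_right h1 h3
      have h5 : 0 ≤ 1 / (pb.qmax : ℝ) := by positivity
      have h6 := mul_nonneg h5 hD0
      rw [h2]
      linarith
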